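/- **Theorem 6.1 (free Pick theorem).** *Setting.* Let $d\in\mathbb N$, and let $\mathbb F^d$ be the free monoid of words in $d$ letters. For $n\in\mathbb N$ let $\mathbb B^d_n$ be the set of $d$-tuples $Z=(Z_1,\dots,Z_d)$ of complex $n\times n$ matrices such that the row operator $[Z_1,\dots,Z_d]:\mathbb C^n\otimes\mathbb C^d\to\mathbb C^n$ has norm $<1$; the NC unit ball is $\mathbb B^d_{\mathbb N}=\bigsqcup_n\mathbb B^d_n$. Write $Z^\alpha=Z_{i_1}\cdots Z_{i_k}$ for $\alpha=i_1\cdots i_k$. The NC Szegő kernel is $$K(Z,W)[P]=\sum_{\alpha\in\mathbb F^d}Z^\alpha P\,(W^{\alpha})^*,\qquad Z\in\mathbb B^d_n,\ W\in\mathbb B^d_m,\ P\in\mathbb C^{n\times m},$$ and for $A\in\mathbb C^{n\times m}\otimes\mathcal L(\mathcal K)$ we also write $K(Z,W)[A]=\sum_\alpha (Z^\alpha\otimes I)A\,(W^{\alpha}\otimes I)^*$. For a complex Hilbert space $\mathcal H$, the $\mathcal H$-valued free Hardy space $H^2(\mathbb B^d_{\mathbb N})\otimes\mathcal H$ consists of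 the functions $f(Z)=\sum_\alpha Z^\alpha\otimes f_\alpha$ on $\mathbb B^d_{\mathbb N}$ with $f_\alpha\in\mathcal H$ and $\|f\|^2=\sum_\alpha\|f_\alpha\|^2<\infty$. Let $\mathcal H,\mathcal K$ be complex Hilbert spaces. A free function with values in $\mathcal L(\mathcal H,\mathcal K)$ is a function $B$ on $\mathbb B^d_{\mathbb N}$ such that $B(Z)\in\mathbb C^{n\times n}\otimes\mathcal L(\mathcal H,\mathcal K)$ for $Z\in\mathbb B^d_n$, and $B(Z)(X\otimes I_{\mathcal H})=(X\otimes I_{\mathcal K})B(W)$ whenever $Z\in\mathbb B^d_n$, $W\in\mathbb B^d_m$, $X\in\mathbb C^{n\times m}$ and $Z_iX=XW_i$ for all $i$. The left Schur class $\mathscr L_d(\mathcal H,\mathcal K)$ consists of those free functions $B$ for which left multiplication $f\mapsto B(Z)f(Z)$ is a contraction from $H^2(\mathbb B^d_{\mathbb N})\otimes\mathcal H$ into $H^2(\mathbb B^d_{\mathbb N})\otimes\mathcal K$. The right Schur class $\mathscr R_d(\mathcal H,\mathcal K)$ consists of those for which right multiplication $f\mapsto B(Z)\bullet_R f(Z)$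 is such a contraction, where $\bullet_R$ is the bilinear product determined by $(b\otimes T)\bullet_R(a\otimes h)=ab\otimes Th$. Let $Z^{(k)}\in\mathbb B^d_{n_k}$ and $W_k\in\mathbb C^{n_k\times n_k}\otimes\mathcal L(\mathcal H,\mathcal K)$ for $1\le k\le N$. Maps between spaces of block matrices partitioned according to $(n_1,\dots,n_N)$ are given by their action on the block $P_{kj}\in\mathbb C^{n_k\times n_j}$. *Claim.* 1. There is $B\in\mathscr L_d(\mathcal H,\mathcal K)$ with $B(Z^{(k)})=W_k$ for all $k$ if and only if the left NC Pick matrix $$[P_{kj}]\longmapsto\Big[K(Z^{(k)},Z^{(j)})[P_{kj}]\otimes I_{\mathcal K}-W_k\big(K(Z^{(k)},Z^{(j)})[P_{kj}]\otimes I_{\mathcal H}\big)W_j^*\Big]_{1\le k,j\le N}$$ is positive semidefinite, i.e. is a completely positive map from block matrices over $\mathbb C$ to block matrices over $\mathcal L(\mathcal K)$. 2. There is $B\in\mathscr R_d(\mathcal H,\mathcal K)$ with $B(Z^{(k)})=W_k$ for all $k$ if and only if the right NC Pick matrix $$[P_{kj}]\longmapsto\Big[K(Z^{(k)},Z^{(j)})[P_{kj}]\otimes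 I_{\mathcal K}-K(Z^{(k)},Z^{(j)})\big[W_k(P_{kj}\otimes I_{\mathcal H})W_j^*\big]\Big]_{1\le k,j\le N}$$ is positive semidefinite in the same sense. -/

import Mathlib

open scoped ComplexOrder

noncomputable section

namespace FreePick

/-! Matrices with entries in a complex vector space `E` represent elements of `ℂ^{m × n} ⊗ E`. -/

/-- `X · A`, the product of `X ⊗ 1` with `A ∈ ℂ^{m × n} ⊗ E`, for a scalar matrix `X`. -/
def lact {l m n E : Type*} [Fintype m] [AddCommGroup E] [Module ℂ E]
    (X : Matrix l m ℂ) (A : Matrix m n E) : Matrix l n E :=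
  Matrix.of fun i j => ∑ k, X i k • A k j

/-- `A · X`, the product of `A ∈ ℂ^{l × m} ⊗ E` with `X ⊗ 1`, for a scalar matrix `X`. -/
def ract {l m n E : Type*} [Fintype m] [AddCommGroup E] [Module ℂ E]
    (A : Matrix l m E) (X : Matrix m n ℂ) : Matrix l n E :=
  Matrix.of fun i j => ∑ k, X k j • A i k

section Operators

variable {H K J : Type*}
  [NormedAddCommGroup H] [InnerProductSpace ℂ H]
  [NormedAddCommGroup K] [InnerProductSpace ℂ K]
  [NormedAddCommGroup J] [InnerProductSpace ℂ J]

/-- `P ⊗ I_K` for a scalar matrix `P`. -/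
def tensorId {m n : Type*} (K : Type*) [NormedAddCommGroup K] [InnerProductSpace ℂ K]
    (P : Matrix m n ℂ) : Matrix m n (K →L[ℂ] K) :=
  Matrix.of fun i j => P i j • ContinuousLinearMap.id ℂ K

/-- The composition of operator matrices. -/
def opMul {l m n : Type*} [Fintype m]
    (A : Matrix l m (H →L[ℂ] K)) (B : Matrix m n (J →L[ℂ] H)) : Matrix l n (J →L[ℂ] K) :=
  Matrix.of fun i j => ∑ k, (A i k).comp (B k j)

/-- The Hilbert space adjoint of an operator matrix. -/
def opAdj {m n : Type*} [CompleteSpace H] [CompleteSpace K]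
    (A : Matrix m n (H →L[ℂ] K)) : Matrix n m (K →L[ℂ] H) :=
  Matrix.of fun i j => ContinuousLinearMap.adjoint (A j i)

/-- The (left) product of `B ∈ ℂ^{n × n} ⊗ L(H, K)` and `f ∈ ℂ^{n × n} ⊗ H`,
determined by `(b ⊗ T) (a ⊗ h) = b a ⊗ T h`. -/
def leftProd {n : Type*} [Fintype n]
    (B : Matrix n n (H →L[ℂ] K)) (f : Matrix n n H) : Matrix n n K :=
  Matrix.of fun i j => ∑ k, B i k (f k j)

/-- The right product of `B ∈ ℂ^{n × n} ⊗ L(H, K)` and `f ∈ ℂ^{n × n} ⊗ H`,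
determined by `(b ⊗ T) • (a ⊗ h) = a b ⊗ T h`. -/
def rightProd {n : Type*} [Fintype n]
    (B : Matrix n n (H →L[ℂ] K)) (f : Matrix n n H) : Matrix n n K :=
  Matrix.of fun i j => ∑ k, B k j (f i k)

/-- Positive semidefiniteness of an operator matrix. -/
def OpPosSemidef {ι : Type*} [Fintype ι] (A : Matrix ι ι (K →L[ℂ] K)) : Prop :=
  ∀ x : ι → K, 0 ≤ ∑ i, ∑ j, inner ℂ (x i) (A i j (x j))

/-- The `r`-th amplification `[P_{ab}] ↦ [Φ(P_{ab})]` of a map `Φ` from matrices to operator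
matrices. -/
def amplify {ι : Type*} (Φ : Matrix ι ι ℂ → Matrix ι ι (K →L[ℂ] K)) (r : ℕ)
    (P : Matrix (Fin r × ι) (Fin r × ι) ℂ) :
    Matrix (Fin r × ι) (Fin r × ι) (K →L[ℂ] K) :=
  Matrix.of fun p q => Φ (Matrix.of fun i j => P (p.1, i) (q.1, j)) p.2 q.2

/-- Complete positivity: every amplification maps positive semidefinite matrices to positive
semidefinite operator matrices. -/
def CompletelyPositive {ι : Type*} [Fintype ι]
    (Φ : Matrix ι ι ℂ → Matrix ι ι (K →L[ℂ] K)) : Prop :=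
  ∀ (r : ℕ) (P : Matrix (Fin r × ι) (Fin r × ι) ℂ),
    P.PosSemidef → OpPosSemidef (amplify Φ r P)

end Operators

open scoped Matrix.Norms.L2Operator in
/-- The `n`-th level of the NC unit ball: the `d`-tuples of `n × n` matrices for which the row
`[Z_1, …, Z_d] : ℂ^n ⊗ ℂ^d → ℂ^n` has operator norm less than one. -/
def ncBall (d n : ℕ) : Set (Fin d → Matrix (Fin n) (Fin n) ℂ) :=
  {Z | ‖(Matrix.of fun i (p : Fin d × Fin n) => Z p.1 i p.2 :
      Matrix (Fin n) (Fin d × Fin n) ℂ)‖ < 1}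

/-- The monomial `Z^α = Z_{i_1} ⋯ Z_{i_k}` for the word `α = i_1 ⋯ i_k`. -/
def word {d n : ℕ} (Z : Fin d → Matrix (Fin n) (Fin n) ℂ) (α : FreeMonoid (Fin d)) :
    Matrix (Fin n) (Fin n) ℂ :=
  FreeMonoid.lift Z α

/-- Graded `E`-valued functions on the NC unit ball. -/
abbrev GradedFun (d : ℕ) (E : Type*) : Type _ :=
  ∀ n : ℕ, ncBall d n → Matrix (Fin n) (Fin n) E

/-- A graded function is free (NC) if it respects intertwinings. -/
def IsFree {d : ℕ} {E : Type*} [AddCommGroup E] [Module ℂ E] (F : GradedFun d E) : Prop :=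
  ∀ (n m : ℕ) (Z : ncBall d n) (W : ncBall d m) (X : Matrix (Fin n) (Fin m) ℂ),
    (∀ i, Z.1 i * X = X * W.1 i) → ract (F n Z) X = lact X (F m W)

/-- The `H`-valued Fock space `F²_d ⊗ H`: square-summable families in `H` indexed by words. -/
abbrev Fock (d : ℕ) (H : Type*) [NormedAddCommGroup H] : Type _ :=
  lp (fun _ : FreeMonoid (Fin d) => H) 2

/-- The element `f(Z) = ∑_α Z^α ⊗ f_α` of the `H`-valued free Hardy space which corresponds to an
element of the `H`-valued Fock space. -/
def hardyFun {d : ℕ} {H : Type*} [NormedAddCommGroup H] [InnerProductSpace ℂ H]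
    (f : Fock d H) : GradedFun d H :=
  fun _ Z => Matrix.of fun i j => ∑' α : FreeMonoid (Fin d), word Z.1 α i j • f α

section Schur

variable (d : ℕ) (H K : Type*)
  [NormedAddCommGroup H] [InnerProductSpace ℂ H] [NormedAddCommGroup K] [InnerProductSpace ℂ K]

/-- The left Schur class: the free functions by which left multiplication maps the `H`-valued free
Hardy space contractively into the `K`-valued one. -/
def leftSchur : Set (GradedFun d (H →L[ℂ] K)) :=
  {B | IsFree B ∧ ∀ f : Fock d H, ∃ g : Fock d K, ‖g‖ ≤ ‖f‖ ∧
    ∀ (n : ℕ) (Z : ncBall d n), hardyFun g n Z = leftProd (B n Z) (hardyFun f n Z)}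

/-- The right Schur class: the free functions by which right multiplication maps the `H`-valued
free Hardy space contractively into the `K`-valued one. -/
def rightSchur : Set (GradedFun d (H →L[ℂ] K)) :=
  {B | IsFree B ∧ ∀ f : Fock d H, ∃ g : Fock d K, ‖g‖ ≤ ‖f‖ ∧
    ∀ (n : ℕ) (Z : ncBall d n), hardyFun g n Z = rightProd (B n Z) (hardyFun f n Z)}

end Schur

/-- The NC Szegő kernel `K(Z, W)[A] = ∑_α Z^α A (W^α)^*`, tensored with the identity of `E`
(so `E = ℂ` gives the scalar kernel). Note that `(W^α)^*` is `(W^*)^{α^†}`, where `α^†` is the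
reversed word. -/
def szego {d n m : ℕ} {E : Type*} [NormedAddCommGroup E] [NormedSpace ℂ E]
    (Z : ncBall d n) (W : ncBall d m) (A : Matrix (Fin n) (Fin m) E) :
    Matrix (Fin n) (Fin m) E :=
  Matrix.of fun i j => ∑' α : FreeMonoid (Fin d),
    lact (word Z.1 α) (ract A (word W.1 α).conjTranspose) i j

section Pick

variable {d N : ℕ} {H K : Type*}
  [NormedAddCommGroup H] [InnerProductSpace ℂ H] [CompleteSpace H]
  [NormedAddCommGroup K] [InnerProductSpace ℂ K] [CompleteSpace K]
  {n : Fin N → ℕ}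

/-- The block `P_{kj}` of a matrix partitioned according to the sizes `n_1, …, n_N`. -/
def block (P : Matrix (Σ k, Fin (n k)) (Σ k, Fin (n k)) ℂ) (k j : Fin N) :
    Matrix (Fin (n k)) (Fin (n j)) ℂ :=
  Matrix.of fun a b => P ⟨k, a⟩ ⟨j, b⟩

/-- The left Pick matrix, as a map on block matrices: `[P_{kj}]` goes to
`[K(Z_k, Z_j)[P_{kj}] ⊗ I_K - W_k (K(Z_k, Z_j)[P_{kj}] ⊗ I_H) W_j^*]`. -/
def leftPick (Z : ∀ k, ncBall d (n k))
    (W : ∀ k, Matrix (Fin (n k)) (Fin (n k)) (H →L[ℂ] K))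
    (P : Matrix (Σ k, Fin (n k)) (Σ k, Fin (n k)) ℂ) :
    Matrix (Σ k, Fin (n k)) (Σ k, Fin (n k)) (K →L[ℂ] K) :=
  Matrix.of fun p q =>
    (tensorId K (szego (Z p.1) (Z q.1) (block P p.1 q.1)) -
      opMul (opMul (W p.1) (tensorId H (szego (Z p.1) (Z q.1) (block P p.1 q.1))))
        (opAdj (W q.1))) p.2 q.2

/-- The right Pick matrix, as a map on block matrices: `[P_{kj}]` goes to
`[K(Z_k, Z_j)[P_{kj}] ⊗ I_K - K(Z_k, Z_j)[W_k (P_{kj} ⊗ I_H) W_j^*]]`. -/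
def rightPick (Z : ∀ k, ncBall d (n k))
    (W : ∀ k, Matrix (Fin (n k)) (Fin (n k)) (H →L[ℂ] K))
    (P : Matrix (Σ k, Fin (n k)) (Σ k, Fin (n k)) ℂ) :
    Matrix (Σ k, Fin (n k)) (Σ k, Fin (n k)) (K →L[ℂ] K) :=
  Matrix.of fun p q =>
    (tensorId K (szego (Z p.1) (Z q.1) (block P p.1 q.1)) -
      szego (Z p.1) (Z q.1)
        (opMul (opMul (W p.1) (tensorId H (block P p.1 q.1))) (opAdj (W q.1)))) p.2 q.2

end Pick

end FreePick

end

noncomputable section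

namespace FreePick

open Filter Topology

/-! ### Words graded by length -/

section Words

variable {d : ℕ}

/-! Both Pick conditions are norm inequalities between combinations of kernel vectors, and the
interpolant comes from a lurking isometry.

Evaluation of the `(i, l)` entry at a point of the ball is a bounded map on the Fock space, whose
adjoint is `kerVec`. The inner products of kernel vectors are the entries of the Szegő kernel. The
quadratic form of an amplified Pick map thus pairs `P` with a difference of two Gram matrices. A
positive semidefinite `P` is a sum of rank-one matrices `star (c p) * c q`, and on these the form is
a difference of squared norms. Complete positivity therefore says that `‖kerSum Z (leftAct W η)‖ ≤
‖kerSum Z η‖` for all coefficients `η`, and likewise with `rightAct` (`completelyPositive_iff`).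

Necessity: the adjoint of multiplication by `B` acts on kernel vectors through the values of `B`,
hence as `leftAct W` or `rightAct W`, and it is a contraction.

Sufficiency is a commutant lifting (`exists_lift`). Kernel vectors span a space invariant under the
backward shifts that strip the last letter of a word, and `leftAct W` commutes with these shifts.
Let `LK`, `LH` be the two kernel sums, with `‖LH v‖ ≤ ‖LK v‖`, and let `q` satisfy `‖q v‖² = ‖LK v‖²
- ‖LH v‖²`. Since `‖f‖² = ‖f 1‖² + ∑ i, ‖R i f‖²` for the backward shifts `R i`, the vectors `((q (R
i v))_i, LK v 1)` and `(q v, LH v 1)` have equal norm. The correspondence between them extends to a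
contraction, and its adjoint is a contractive colligation. The input-output map of that colligation
is a contraction by energy balance and a left multiplier by shift invariance. Its adjoint sends `LK
v` to `LH v`, because the iterated backward shifts of a Fock space vector tend to zero
(`inner_ioMap`).

Evaluating this relation on constants shows that the multiplier takes the values `W k`. The
right-hand case follows by reversing words. -/

theorem of_mul_injective :
    Function.Injective fun p : Fin d × FreeMonoid (Fin d) => FreeMonoid.of p.1 * p.2 := by
  intro p q h
  have h' : p.1 :: p.2.toList = q.1 :: q.2.toList := h
  rw [List.cons.injEq] at h'
  exact Prod.ext h'.1 (FreeMonoid.toList.injective h'.2)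

/-- The words of length `n`. -/
def sphere (d : ℕ) : ℕ → Finset (FreeMonoid (Fin d))
  | 0 => {1}
  | n + 1 => (Finset.univ ×ˢ sphere d n).map
      ⟨fun p => FreeMonoid.of p.1 * p.2, of_mul_injective⟩

theorem sum_sphere_succ {E : Type*} [AddCommMonoid E] (n : ℕ) (g : FreeMonoid (Fin d) → E) :
    ∑ a ∈ sphere d (n + 1), g a = ∑ a ∈ sphere d n, ∑ i, g (FreeMonoid.of i * a) := by
  rw [sphere, Finset.sum_map, Finset.sum_product_right]
  rfl

theorem mem_sphere (n : ℕ) (a : FreeMonoid (Fin d)) : a ∈ sphere d n ↔ a.length = n := by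
  induction n generalizing a with
  | zero => simp [sphere, FreeMonoid.length_eq_zero]
  | succ n ih =>
    simp only [sphere, Finset.mem_map, Finset.mem_product, Finset.mem_univ, true_and, ih,
      Function.Embedding.coeFn_mk, Prod.exists]
    constructor
    · rintro ⟨i, b, hb, rfl⟩
      rw [FreeMonoid.length_mul, hb, FreeMonoid.length_of, add_comm]
    · intro h
      induction a using FreeMonoid.inductionOn' with
      | one => simp at h
      | of_mul i b =>
        refine ⟨i, b, ?_, rfl⟩
        rw [FreeMonoid.length_mul, FreeMonoid.length_of] at h
        omega

theorem pairwiseDisjoint_sphere (s : Set ℕ) : s.PairwiseDisjoint (sphere d) := by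
  intro i _ j _ hij
  refine Finset.disjoint_left.2 fun a ha hb => hij ?_
  rw [mem_sphere] at ha hb
  rw [← ha, hb]

/-- The words of length less than `n`. -/
def wordBall (d n : ℕ) : Finset (FreeMonoid (Fin d)) :=
  (Finset.range n).disjiUnion (sphere d) (pairwiseDisjoint_sphere _)

theorem mem_wordBall (n : ℕ) (a : FreeMonoid (Fin d)) : a ∈ wordBall d n ↔ a.length < n := by
  rw [wordBall, Finset.mem_disjiUnion]
  simp only [mem_sphere, Finset.mem_range, exists_eq_right']

theorem sum_wordBall {E : Type*} [AddCommMonoid E] (n : ℕ) (g : FreeMonoid (Fin d) → E) :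
    ∑ a ∈ wordBall d n, g a = ∑ m ∈ Finset.range n, ∑ a ∈ sphere d m, g a :=
  Finset.sum_disjiUnion _ _ _

theorem sum_wordBall_succ {E : Type*} [AddCommMonoid E] (n : ℕ) (g : FreeMonoid (Fin d) → E) :
    ∑ a ∈ wordBall d (n + 1), g a = ∑ a ∈ wordBall d n, g a + ∑ a ∈ sphere d n, g a := by
  rw [sum_wordBall, sum_wordBall, Finset.sum_range_succ]

theorem tendsto_wordBall (d : ℕ) : Tendsto (wordBall d) atTop atTop := by
  refine tendsto_atTop_finset_of_monotone (fun m n h a ha => ?_) fun a => ⟨a.length + 1, ?_⟩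
  · rw [mem_wordBall] at *; omega
  · rw [mem_wordBall]; omega

theorem exists_subset_wordBall (s : Finset (FreeMonoid (Fin d))) : ∃ n, s ⊆ wordBall d n := by
  obtain ⟨n, hn⟩ := ((tendsto_wordBall d).eventually (eventually_ge_atTop s)).exists
  exact ⟨n, hn⟩

end Words

/-! ### Extension of contractive relations, and defect operators -/

section HilbertSpace

/-- A linear relation between Hilbert spaces which is norm decreasing extends to a contraction. -/
theorem exists_contraction {V E F : Type*} [AddCommGroup V] [Module ℂ V]
    [NormedAddCommGroup E] [InnerProductSpace ℂ E] [CompleteSpace E]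
    [NormedAddCommGroup F] [InnerProductSpace ℂ F] [CompleteSpace F]
    (a : V →ₗ[ℂ] E) (b : V →ₗ[ℂ] F) (h : ∀ v, ‖b v‖ ≤ ‖a v‖) :
    ∃ T : E →L[ℂ] F, (∀ x, ‖T x‖ ≤ ‖x‖) ∧ ∀ v, T (a v) = b v := by
  let M := (LinearMap.range a).topologicalClosure
  have hM : ∀ v, a v ∈ M := fun v =>
    Submodule.le_topologicalClosure _ (LinearMap.mem_range_self a v)
  have : CompleteSpace M := (Submodule.isClosed_topologicalClosure _).completeSpace_coe
  let e : V →ₗ[ℂ] M := a.codRestrict M hM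
  -- The bound `h` makes `b` factor through the range of `a`. The factor extends by continuity to
  -- the closure `M`, and by zero to its orthogonal complement.
  have he : DenseRange e := by
    rw [DenseRange, dense_iff_closure_eq, Set.eq_univ_iff_forall]
    intro x
    rw [closure_subtype]
    have hx : (x : E) ∈ closure (LinearMap.range a : Set E) := x.2
    refine closure_mono ?_ hx
    rintro _ ⟨v, rfl⟩
    exact ⟨e v, ⟨v, rfl⟩, rfl⟩
  have hb : ∀ v, ‖b v‖ ≤ 1 * ‖e v‖ := fun v => by simpa [e] using h v
  refine ⟨(b.extendOfNorm e).comp M.orthogonalProjectionOnto, fun x => ?_, fun v => ?_⟩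
  · refine (LinearMap.norm_extendOfNorm_apply_le he 1 hb _).trans ?_
    rw [one_mul]
    exact M.norm_orthogonalProjectionOnto_apply_le x
  · have : M.orthogonalProjectionOnto (a v) = e v :=
      M.orthogonalProjectionOnto_mem_subspace_eq_self (e v)
    rw [ContinuousLinearMap.comp_apply, this, LinearMap.extendOfNorm_eq he ⟨1, hb⟩]

/-- The defect operator of a contraction. -/
theorem exists_defect {E F : Type*}
    [NormedAddCommGroup E] [InnerProductSpace ℂ E] [CompleteSpace E]
    [NormedAddCommGroup F] [InnerProductSpace ℂ F] [CompleteSpace F]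
    (T : E →L[ℂ] F) (h : ∀ x, ‖T x‖ ≤ ‖x‖) :
    ∃ D : E →L[ℂ] E, ∀ x, ‖D x‖ ^ 2 + ‖T x‖ ^ 2 = ‖x‖ ^ 2 := by
  have hre : ∀ x, RCLike.re (inner ℂ ((1 - T.adjoint.comp T) x) x) = ‖x‖ ^ 2 - ‖T x‖ ^ 2 := by
    intro x
    simp only [_root_.sub_apply, ContinuousLinearMap.one_def, ContinuousLinearMap.id_apply,
      ContinuousLinearMap.comp_apply, inner_sub_left, ContinuousLinearMap.adjoint_inner_left,
      map_sub, inner_self_eq_norm_sq]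
  have hpos : 0 ≤ (1 - T.adjoint.comp T : E →L[ℂ] E) := by
    rw [ContinuousLinearMap.nonneg_iff_isPositive, ContinuousLinearMap.isPositive_def']
    refine ⟨?_, fun x => ?_⟩
    · exact (IsSelfAdjoint.one _).sub (ContinuousLinearMap.isPositive_adjoint_comp_self T).isSelfAdjoint
    · rw [ContinuousLinearMap.reApplyInnerSelf_apply, hre]
      have := pow_le_pow_left₀ (norm_nonneg _) (h x) 2
      linarith
  obtain ⟨D, hD⟩ := CStarAlgebra.nonneg_iff_eq_star_mul_self.1 hpos
  refine ⟨D, fun x => ?_⟩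
  have h1 := hre x
  rw [hD, mul_apply_eq_comp, ContinuousLinearMap.star_eq_adjoint,
    ContinuousLinearMap.adjoint_inner_left, inner_self_eq_norm_sq] at h1
  linarith

end HilbertSpace

/-! ### Noncommutative linear systems indexed by words -/

section Colligation

variable {d : ℕ} {X H K : Type*}
  [NormedAddCommGroup X] [InnerProductSpace ℂ X]
  [NormedAddCommGroup H] [InnerProductSpace ℂ H]
  [NormedAddCommGroup K] [InnerProductSpace ℂ K]

/-- The type of a colligation with state space `X`, input space `H` and output space `K`. -/
abbrev Colligation (d : ℕ) (X H K : Type*)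
    [NormedAddCommGroup X] [InnerProductSpace ℂ X]
    [NormedAddCommGroup H] [InnerProductSpace ℂ H]
    [NormedAddCommGroup K] [InnerProductSpace ℂ K] : Type _ :=
  WithLp 2 (X × H) →L[ℂ] WithLp 2 (PiLp 2 (fun _ : Fin d => X) × K)

/-- The state trajectory, with zero initial state, driven by the input `u`. -/
def state (U : Colligation d X H K) (u : FreeMonoid (Fin d) → H) (a : FreeMonoid (Fin d)) : X :=
  FreeMonoid.recOn a 0 fun i b x => (U (WithLp.toLp 2 (x, u b))).fst i

/-- The output driven by the input `u`. -/
def output (U : Colligation d X H K) (u : FreeMonoid (Fin d) → H) (a : FreeMonoid (Fin d)) : K :=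
  (U (WithLp.toLp 2 (state U u a, u a))).snd

@[simp]
theorem state_one (U : Colligation d X H K) (u : FreeMonoid (Fin d) → H) : state U u 1 = 0 := rfl

theorem state_of_mul (U : Colligation d X H K) (u : FreeMonoid (Fin d) → H) (i : Fin d)
    (a : FreeMonoid (Fin d)) :
    state U u (FreeMonoid.of i * a) = (U (WithLp.toLp 2 (state U u a, u a))).fst i := rfl

theorem state_add (U : Colligation d X H K) (u v : FreeMonoid (Fin d) → H)
    (a : FreeMonoid (Fin d)) : state U (u + v) a = state U u a + state U v a := by
  induction a using FreeMonoid.inductionOn' with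
  | one => simp
  | of_mul i a ih =>
    simp only [state_of_mul, ih, Pi.add_apply]
    rw [← Prod.mk_add_mk, WithLp.toLp_add, map_add]
    rfl

theorem state_smul (U : Colligation d X H K) (c : ℂ) (u : FreeMonoid (Fin d) → H)
    (a : FreeMonoid (Fin d)) : state U (c • u) a = c • state U u a := by
  induction a using FreeMonoid.inductionOn' with
  | one => simp
  | of_mul i a ih =>
    simp only [state_of_mul, ih, Pi.smul_apply]
    rw [← Prod.smul_mk, WithLp.toLp_smul, map_smul]
    rfl

theorem output_add (U : Colligation d X H K) (u v : FreeMonoid (Fin d) → H)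
    (a : FreeMonoid (Fin d)) : output U (u + v) a = output U u a + output U v a := by
  simp only [output, state_add, Pi.add_apply]
  rw [← Prod.mk_add_mk, WithLp.toLp_add, map_add]
  rfl

theorem output_smul (U : Colligation d X H K) (c : ℂ) (u : FreeMonoid (Fin d) → H)
    (a : FreeMonoid (Fin d)) : output U (c • u) a = c • output U u a := by
  simp only [output, state_smul, Pi.smul_apply]
  rw [← Prod.smul_mk, WithLp.toLp_smul, map_smul]
  rfl

/-- Energy balance: a contractive `U` dissipates energy at each word, and summing over the words of
one length telescopes. The initial state contributes nothing because it is zero. -/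
theorem energy_le (U : Colligation d X H K) (hU : ∀ z, ‖U z‖ ≤ ‖z‖)
    (u : FreeMonoid (Fin d) → H) (n : ℕ) :
    ∑ a ∈ sphere d n, ‖state U u a‖ ^ 2 + ∑ a ∈ wordBall d n, ‖output U u a‖ ^ 2 ≤
      ∑ a ∈ wordBall d n, ‖u a‖ ^ 2 := by
  induction n with
  | zero => simp [sphere, wordBall]
  | succ n ih =>
    rw [sum_sphere_succ, sum_wordBall_succ, sum_wordBall_succ]
    have h : ∑ a ∈ sphere d n, (∑ i, ‖state U u (FreeMonoid.of i * a)‖ ^ 2 + ‖output U u a‖ ^ 2) ≤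
        ∑ a ∈ sphere d n, (‖state U u a‖ ^ 2 + ‖u a‖ ^ 2) := by
      refine Finset.sum_le_sum fun a _ => ?_
      have := pow_le_pow_left₀ (norm_nonneg _) (hU (WithLp.toLp 2 (state U u a, u a))) 2
      rw [WithLp.prod_norm_sq_eq_of_L2, WithLp.prod_norm_sq_eq_of_L2, PiLp.norm_sq_eq_of_L2] at this
      exact this
    rw [Finset.sum_add_distrib, Finset.sum_add_distrib] at h
    linarith

section Single

open scoped Classical in
theorem single_mul_apply {E : Type*} [AddCommGroup E] (g : FreeMonoid (Fin d)) (h : E) (b : FreeMonoid (Fin d)) :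
    (Pi.single g h : FreeMonoid (Fin d) → E) (b * g) =
      (Pi.single 1 h : FreeMonoid (Fin d) → E) b := by
  by_cases hb : b = 1
  · rw [hb, one_mul, Pi.single_eq_same, Pi.single_eq_same]
  · rw [Pi.single_eq_of_ne hb, Pi.single_eq_of_ne]
    exact fun h => hb (mul_eq_right.1 h)

open scoped Classical in
theorem state_single_eq_zero (U : Colligation d X H K) (g : FreeMonoid (Fin d)) (h : H)
    (a : FreeMonoid (Fin d)) (ha : ∀ i b, a ≠ FreeMonoid.of i * b * g) :
    state U (Pi.single g h) a = 0 := by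
  induction a using FreeMonoid.inductionOn' with
  | one => rfl
  | of_mul i a ih =>
    have h1 : a ≠ g := fun h => ha i 1 (by rw [h, mul_one])
    rw [state_of_mul, ih fun j b hab => ha i (FreeMonoid.of j * b) (by rw [hab]; simp only [mul_assoc]),
      Pi.single_eq_of_ne h1, Prod.mk_zero_zero, WithLp.toLp_zero, map_zero]
    rfl

-- Shift invariance: the recursion prepends letters, so an impulse at `g` produces the same response
-- as an impulse at the empty word, with `g` appended on the right.
open scoped Classical in
theorem state_single_mul (U : Colligation d X H K) (g : FreeMonoid (Fin d)) (h : H)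
    (b : FreeMonoid (Fin d)) :
    state U (Pi.single g h) (b * g) = state U (Pi.single 1 h) b := by
  induction b using FreeMonoid.inductionOn' with
  | one =>
    rw [one_mul, state_one, state_single_eq_zero]
    intro i b hb
    have := congrArg FreeMonoid.length hb
    simp only [FreeMonoid.length_mul, FreeMonoid.length_of] at this
    omega
  | of_mul i b ih =>
    rw [mul_assoc, state_of_mul, state_of_mul, ih, single_mul_apply]

open scoped Classical in
theorem output_single_eq_zero (U : Colligation d X H K) (g : FreeMonoid (Fin d)) (h : H)
    (a : FreeMonoid (Fin d)) (ha : ∀ b, a ≠ b * g) :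
    output U (Pi.single g h) a = 0 := by
  rw [output, state_single_eq_zero U g h a fun i b => ha _, Pi.single_eq_of_ne]
  · rw [Prod.mk_zero_zero, WithLp.toLp_zero, map_zero]
    rfl
  · exact fun h => ha 1 (by rw [h, one_mul])

open scoped Classical in
theorem output_single_mul (U : Colligation d X H K) (g : FreeMonoid (Fin d)) (h : H)
    (b : FreeMonoid (Fin d)) :
    output U (Pi.single g h) (b * g) = output U (Pi.single 1 h) b := by
  rw [output, output, state_single_mul, single_mul_apply]

end Single

end Colligation

/-! ### Norms and backward shifts on the Fock space -/

section FockSpace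

variable {d : ℕ} {H K : Type*}
  [NormedAddCommGroup H] [InnerProductSpace ℂ H]
  [NormedAddCommGroup K] [InnerProductSpace ℂ K]

omit [InnerProductSpace ℂ H] in
theorem hasSum_norm_sq (f : Fock d H) : HasSum (fun a => ‖f a‖ ^ 2) (‖f‖ ^ 2) := by
  have := lp.hasSum_norm (p := 2) (by norm_num) f
  simpa using this

theorem memℓp_two_of_sum_le {E : Type*} [NormedAddCommGroup E] {f : FreeMonoid (Fin d) → E}
    {C : ℝ} (h : ∀ n, ∑ a ∈ wordBall d n, ‖f a‖ ^ 2 ≤ C) :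
    Memℓp (E := fun _ : FreeMonoid (Fin d) => E) f 2 := by
  refine memℓp_gen' (C := C) fun s => ?_
  obtain ⟨n, hn⟩ := exists_subset_wordBall s
  refine le_trans ?_ (h n)
  simp only [ENNReal.toReal_ofNat, Real.rpow_ofNat]
  exact Finset.sum_le_sum_of_subset_of_nonneg hn fun _ _ _ => by positivity

omit [InnerProductSpace ℂ H] in
theorem sum_norm_sq_le (f : Fock d H) (n : ℕ) : ∑ a ∈ wordBall d n, ‖f a‖ ^ 2 ≤ ‖f‖ ^ 2 :=
  sum_le_hasSum _ (fun _ _ => by positivity) (hasSum_norm_sq f)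

omit [InnerProductSpace ℂ H] in
theorem norm_le_of_sum_le {f : Fock d H} {C : ℝ} (hC : 0 ≤ C)
    (h : ∀ n, ∑ a ∈ wordBall d n, ‖f a‖ ^ 2 ≤ C ^ 2) : ‖f‖ ≤ C := by
  refine lp.norm_le_of_forall_sum_le (p := 2) (by norm_num) hC fun s => ?_
  obtain ⟨n, hn⟩ := exists_subset_wordBall s
  simp only [ENNReal.toReal_ofNat, Real.rpow_ofNat]
  exact (Finset.sum_le_sum_of_subset_of_nonneg hn fun _ _ _ => by positivity).trans (h n)

/-- The coefficient of a word as a linear map. -/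
def coeff (d : ℕ) (H : Type*) [NormedAddCommGroup H] [InnerProductSpace ℂ H]
    (a : FreeMonoid (Fin d)) : Fock d H →ₗ[ℂ] H where
  toFun f := f a
  map_add' _ _ := rfl
  map_smul' _ _ := rfl

@[simp]
theorem coeff_apply (a : FreeMonoid (Fin d)) (f : Fock d H) : coeff d H a f = f a := rfl

theorem sum_sphere_succ_snoc {E : Type*} [AddCommMonoid E] (n : ℕ)
    (g : FreeMonoid (Fin d) → E) :
    ∑ a ∈ sphere d (n + 1), g a = ∑ a ∈ sphere d n, ∑ i, g (a * FreeMonoid.of i) := by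
  induction n generalizing g with
  | zero => rw [sum_sphere_succ]; simp [sphere]
  | succ n ih =>
    rw [sum_sphere_succ, ih fun a => ∑ i, g (FreeMonoid.of i * a), sum_sphere_succ]
    refine Finset.sum_congr rfl fun a _ => ?_
    rw [Finset.sum_comm]
    simp only [mul_assoc]

-- A nonempty word is determined by its last letter and the rest, so the vectors `g i` collect all
-- coefficients of `f` except the one at the empty word.
omit [InnerProductSpace ℂ H] in
theorem norm_sq_eq_add_sum {f : Fock d H} {g : Fin d → Fock d H}
    (h : ∀ i a, g i a = f (a * FreeMonoid.of i)) :
    ‖f‖ ^ 2 = ‖f 1‖ ^ 2 + ∑ i, ‖g i‖ ^ 2 := by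
  have h1 := ((hasSum_norm_sq f).comp (tendsto_wordBall d)).comp (tendsto_add_atTop_nat 1)
  have h2 : Tendsto (fun n => ‖f 1‖ ^ 2 + ∑ i, ∑ a ∈ wordBall d n, ‖g i a‖ ^ 2) atTop
      (𝓝 (‖f 1‖ ^ 2 + ∑ i, ‖g i‖ ^ 2)) :=
    tendsto_const_nhds.add (tendsto_finsetSum _ fun i _ =>
      (hasSum_norm_sq (g i)).comp (tendsto_wordBall d))
  refine tendsto_nhds_unique h1 (h2.congr fun n => ?_)
  simp only [Function.comp_apply, sum_wordBall]
  rw [Finset.sum_range_succ', Finset.sum_comm, add_comm]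
  congr 1
  · refine Finset.sum_congr rfl fun m _ => ?_
    rw [sum_sphere_succ_snoc, Finset.sum_comm]
    simp only [h]
  · simp [sphere]

end FockSpace

/-! ### Commutant lifting by a lurking isometry -/

section CommutantLifting

variable {d : ℕ} {X H K : Type*}
  [NormedAddCommGroup X] [InnerProductSpace ℂ X]
  [NormedAddCommGroup H] [InnerProductSpace ℂ H]
  [NormedAddCommGroup K] [InnerProductSpace ℂ K]

theorem sum_norm_output_le (U : Colligation d X H K) (hU : ∀ z, ‖U z‖ ≤ ‖z‖) (u : Fock d H)
    (n : ℕ) : ∑ a ∈ wordBall d n, ‖output U u a‖ ^ 2 ≤ ‖u‖ ^ 2 := by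
  refine le_trans ?_ ((energy_le U hU u n).trans (sum_norm_sq_le u n))
  exact le_add_of_nonneg_left (by positivity)

theorem sum_norm_state_le (U : Colligation d X H K) (hU : ∀ z, ‖U z‖ ≤ ‖z‖) (u : Fock d H)
    (n : ℕ) : ∑ a ∈ sphere d n, ‖state U u a‖ ^ 2 ≤ ‖u‖ ^ 2 := by
  refine le_trans ?_ ((energy_le U hU u n).trans (sum_norm_sq_le u n))
  exact le_add_of_nonneg_right (by positivity)

/-- The input-output map of a contractive colligation. -/
def ioMap (U : Colligation d X H K) (hU : ∀ z, ‖U z‖ ≤ ‖z‖) : Fock d H →L[ℂ] Fock d K :=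
  LinearMap.mkContinuous
    { toFun := fun u => ⟨output U u, memℓp_two_of_sum_le (sum_norm_output_le U hU u)⟩
      map_add' := fun u v => Subtype.ext (funext fun a => output_add U u v a)
      map_smul' := fun c u => Subtype.ext (funext fun a => output_smul U c u a) } 1
    fun u => by
      rw [one_mul]
      exact norm_le_of_sum_le (norm_nonneg _) (sum_norm_output_le U hU u)

theorem ioMap_apply (U : Colligation d X H K) (hU : ∀ z, ‖U z‖ ≤ ‖z‖) (u : Fock d H)
    (a : FreeMonoid (Fin d)) : ioMap U hU u a = output U u a := rfl

theorem norm_ioMap_le (U : Colligation d X H K) (hU : ∀ z, ‖U z‖ ≤ ‖z‖) (u : Fock d H) :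
    ‖ioMap U hU u‖ ≤ ‖u‖ :=
  norm_le_of_sum_le (norm_nonneg _) (sum_norm_output_le U hU u)

/-- The composition of operators along a word. -/
def wordApply {V : Type*} (R : Fin d → V → V) (v : V) (a : FreeMonoid (Fin d)) : V :=
  FreeMonoid.recOn a v fun i _ w => R i w

omit [InnerProductSpace ℂ K] in
theorem apply_wordApply {V : Type*} (R : Fin d → V → V) (L : V → Fock d K)
    (hL : ∀ i v a, L (R i v) a = L v (a * FreeMonoid.of i)) (v : V) (a b : FreeMonoid (Fin d)) :
    L (wordApply R v a) b = L v (b * a) := by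
  induction a using FreeMonoid.inductionOn' generalizing b with
  | one => rw [mul_one]; rfl
  | of_mul i a ih =>
    rw [show wordApply R v (FreeMonoid.of i * a) = R i (wordApply R v a) from rfl, hL, ih,
      mul_assoc]

-- Both sides are the part of `‖L v‖²` carried by words of length at least `n`; each backward shift
-- removes the coefficient at the empty word. Hence the sum tends to zero.
omit [InnerProductSpace ℂ K] in
theorem sum_norm_wordApply {V : Type*} (R : Fin d → V → V) (L : V → Fock d K)
    (hL : ∀ i v a, L (R i v) a = L v (a * FreeMonoid.of i)) (v : V) (n : ℕ) :
    ∑ a ∈ sphere d n, ‖L (wordApply R v a)‖ ^ 2 =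
      ‖L v‖ ^ 2 - ∑ a ∈ wordBall d n, ‖L v a‖ ^ 2 := by
  induction n with
  | zero => simp [sphere, wordBall, wordApply]
  | succ n ih =>
    rw [sum_sphere_succ, sum_wordBall_succ, ← sub_sub, ← ih, ← Finset.sum_sub_distrib]
    refine Finset.sum_congr rfl fun a _ => ?_
    have := norm_sq_eq_add_sum (f := L (wordApply R v a))
      (g := fun i => L (R i (wordApply R v a))) fun i b => hL i _ b
    rw [apply_wordApply R L hL, one_mul] at this
    rw [this, add_sub_cancel_left]
    rfl

omit [InnerProductSpace ℂ K] in
theorem tendsto_sum_norm_wordApply {V : Type*} (R : Fin d → V → V) (L : V → Fock d K)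
    (hL : ∀ i v a, L (R i v) a = L v (a * FreeMonoid.of i)) (v : V) :
    Tendsto (fun n => ∑ a ∈ sphere d n, ‖L (wordApply R v a)‖ ^ 2) atTop (𝓝 0) := by
  simp only [sum_norm_wordApply R L hL]
  rw [← sub_self (‖L v‖ ^ 2)]
  exact tendsto_const_nhds.sub ((hasSum_norm_sq (L v)).comp (tendsto_wordBall d))

/-- If a colligation intertwines the data given by a family of coinvariant vectors, then so does
its input-output map. -/
theorem inner_ioMap [CompleteSpace K] {V : Type*} (R : Fin d → V → V)
    (LK : V → Fock d K) (LH : V → Fock d H)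
    (hK : ∀ i v a, LK (R i v) a = LK v (a * FreeMonoid.of i))
    (hH : ∀ i v a, LH (R i v) a = LH v (a * FreeMonoid.of i))
    (q : V → X) (hq : ∀ v, ‖q v‖ ≤ ‖LK v‖)
    (U : Colligation d X H K) (hU : ∀ z, ‖U z‖ ≤ ‖z‖)
    (h : ∀ v z, ∑ i, inner ℂ (q (R i v)) ((U z).fst i) + inner ℂ (LK v 1) (U z).snd =
      inner ℂ (q v) z.fst + inner ℂ (LH v 1) z.snd) (v : V) (u : Fock d H) :
    inner ℂ (LK v) (ioMap U hU u) = inner ℂ (LH v) u := by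
  -- The hypothesis `h`, applied at each word of length `n` to the current state and input, makes
  -- this a telescoping identity.
  have key : ∀ n, ∑ a ∈ wordBall d n, inner ℂ (LK v a) (output U u a) +
      ∑ a ∈ sphere d n, inner ℂ (q (wordApply R v a)) (state U u a) =
        ∑ a ∈ wordBall d n, inner ℂ (LH v a) (u a) := by
    intro n
    induction n with
    | zero => simp [sphere, wordBall]
    | succ n ih =>
      rw [sum_wordBall_succ, sum_wordBall_succ, ← ih, sum_sphere_succ, add_assoc, add_assoc,
        ← Finset.sum_add_distrib, ← Finset.sum_add_distrib]
      congr 1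
      refine Finset.sum_congr rfl fun a _ => ?_
      have := h (wordApply R v a) (WithLp.toLp 2 (state U u a, u a))
      rw [apply_wordApply R LK hK, apply_wordApply R LH hH, one_mul] at this
      rw [add_comm]
      exact this
  -- By Cauchy–Schwarz: the states on a sphere have square sum at most `‖u‖²`, while the factors
  -- with `q` are dominated by a tail of `‖LK v‖²`.
  have hrem : Tendsto (fun n => ∑ a ∈ sphere d n,
      inner ℂ (q (wordApply R v a)) (state U u a)) atTop (𝓝 0) := by
    have hsq : Tendsto (fun n => √((∑ a ∈ sphere d n, ‖LK (wordApply R v a)‖ ^ 2) * ‖u‖ ^ 2))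
        atTop (𝓝 0) := by
      have := ((tendsto_sum_norm_wordApply R LK hK v).mul_const (‖u‖ ^ 2)).sqrt
      simpa using this
    refine squeeze_zero_norm (fun n => ?_) hsq
    refine Real.le_sqrt_of_sq_le ?_
    calc ‖∑ a ∈ sphere d n, inner ℂ (q (wordApply R v a)) (state U u a)‖ ^ 2
        ≤ (∑ a ∈ sphere d n, ‖LK (wordApply R v a)‖ * ‖state U u a‖) ^ 2 := by
          refine pow_le_pow_left₀ (norm_nonneg _) ((norm_sum_le _ _).trans
            (Finset.sum_le_sum fun a _ => (norm_inner_le_norm _ _).trans ?_)) 2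
          gcongr
          exact hq _
      _ ≤ (∑ a ∈ sphere d n, ‖LK (wordApply R v a)‖ ^ 2) *
            ∑ a ∈ sphere d n, ‖state U u a‖ ^ 2 := Finset.sum_mul_sq_le_sq_mul_sq _ _ _
      _ ≤ _ := by
          gcongr
          exact sum_norm_state_le U hU u n
  have h1 := ((lp.hasSum_inner (𝕜 := ℂ) (LK v) (ioMap U hU u)).comp (tendsto_wordBall d)).add hrem
  rw [add_zero] at h1
  exact tendsto_nhds_unique h1 (((lp.hasSum_inner (𝕜 := ℂ) (LH v) u).comp
    (tendsto_wordBall d)).congr fun n => (key n).symm)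

open scoped Classical in
/-- Commutant lifting for the right backward shifts, by a lurking isometry. -/
theorem exists_lift [CompleteSpace H] [CompleteSpace K] {V : Type*} [AddCommGroup V] [Module ℂ V]
    (R : Fin d → V →ₗ[ℂ] V) (LK : V →ₗ[ℂ] Fock d K) (LH : V →ₗ[ℂ] Fock d H)
    (hK : ∀ i v a, LK (R i v) a = LK v (a * FreeMonoid.of i))
    (hH : ∀ i v a, LH (R i v) a = LH v (a * FreeMonoid.of i))
    (hle : ∀ v, ‖LH v‖ ≤ ‖LK v‖) :
    ∃ F : Fock d H →L[ℂ] Fock d K, (∀ u, ‖F u‖ ≤ ‖u‖) ∧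
      (∀ g h b, F (lp.single 2 g h) (b * g) = F (lp.single 2 1 h) b) ∧
      (∀ g h a, (∀ b, a ≠ b * g) → F (lp.single 2 g h) a = 0) ∧
      ∀ v u, inner ℂ (LK v) (F u) = inner ℂ (LH v) u := by
  obtain ⟨T, hT, hTL⟩ := exists_contraction LK LH hle
  obtain ⟨D, hD⟩ := exists_defect T hT
  let q : V →ₗ[ℂ] Fock d K := D.toLinearMap ∘ₗ LK
  have hq : ∀ v, ‖q v‖ ^ 2 = ‖LK v‖ ^ 2 - ‖LH v‖ ^ 2 := by
    intro v
    have := hD (LK v)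
    rw [hTL] at this
    rw [← this, add_sub_cancel_right]
    rfl
  let α : V →ₗ[ℂ] WithLp 2 (PiLp 2 (fun _ : Fin d => Fock d K) × K) :=
    (WithLp.linearEquiv 2 ℂ _).symm.toLinearMap ∘ₗ LinearMap.prod
      ((WithLp.linearEquiv 2 ℂ _).symm.toLinearMap ∘ₗ LinearMap.pi fun i => q ∘ₗ R i)
      (coeff d K 1 ∘ₗ LK)
  let β : V →ₗ[ℂ] WithLp 2 (Fock d K × H) :=
    (WithLp.linearEquiv 2 ℂ _).symm.toLinearMap ∘ₗ LinearMap.prod q (coeff d H 1 ∘ₗ LH)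
  have hα : ∀ v, ‖α v‖ ^ 2 = ∑ i, ‖q (R i v)‖ ^ 2 + ‖LK v 1‖ ^ 2 := by
    intro v
    rw [WithLp.prod_norm_sq_eq_of_L2, PiLp.norm_sq_eq_of_L2]
    rfl
  have hβ : ∀ v, ‖β v‖ ^ 2 = ‖q v‖ ^ 2 + ‖LH v 1‖ ^ 2 := by
    intro v
    rw [WithLp.prod_norm_sq_eq_of_L2]
    rfl
  -- The lurking isometry. The two norms are in fact equal, by splitting off the empty word from `LK
  -- v` and from `LH v`; the inequality suffices for the extension.
  have hαβ : ∀ v, ‖β v‖ ≤ ‖α v‖ := by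
    intro v
    rw [← sq_le_sq₀ (norm_nonneg _) (norm_nonneg _), hα, hβ]
    simp only [hq, Finset.sum_sub_distrib]
    have h1 := norm_sq_eq_add_sum (f := LK v) fun i a => hK i v a
    have h2 := norm_sq_eq_add_sum (f := LH v) fun i a => hH i v a
    linarith
  obtain ⟨S, hS, hSαβ⟩ := exists_contraction α β hαβ
  -- The extension `S` sends `α v` to `β v`, so it runs from outputs to inputs; the colligation is
  -- its adjoint.
  have hU : ∀ z, ‖S.adjoint z‖ ≤ ‖z‖ := by
    intro z
    refine (S.adjoint.le_opNorm z).trans ?_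
    rw [LinearIsometryEquiv.norm_map]
    exact mul_le_of_le_one_left (norm_nonneg _)
      (S.opNorm_le_bound zero_le_one fun x => by rw [one_mul]; exact hS x)
  refine ⟨ioMap S.adjoint hU, norm_ioMap_le _ hU, fun g h b => ?_, fun g h a ha => ?_, ?_⟩
  · rw [ioMap_apply, ioMap_apply, lp.coeFn_single, lp.coeFn_single]
    exact output_single_mul _ g h b
  · rw [ioMap_apply, lp.coeFn_single]
    exact output_single_eq_zero _ g h a ha
  · refine inner_ioMap (fun i v => R i v) LK LH hK hH q (fun v => ?_) _ hU fun v z => ?_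
    · rw [← sq_le_sq₀ (norm_nonneg _) (norm_nonneg _), hq]
      exact sub_le_self _ (by positivity)
    · have : inner ℂ (α v) (S.adjoint z) = inner ℂ (β v) z := by
        rw [ContinuousLinearMap.adjoint_inner_right, hSαβ]
      rw [WithLp.prod_inner_apply, WithLp.prod_inner_apply, PiLp.inner_apply] at this
      exact this

end CommutantLifting

/-! ### Point evaluations and kernel vectors -/

section Evaluation

variable {d n m : ℕ}

theorem word_of_mul (Z : Fin d → Matrix (Fin n) (Fin n) ℂ) (i : Fin d) (a : FreeMonoid (Fin d)) :
    word Z (FreeMonoid.of i * a) = Z i * word Z a := by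
  rw [word, map_mul, FreeMonoid.lift_eval_of]
  rfl

theorem word_mul (Z : Fin d → Matrix (Fin n) (Fin n) ℂ) (a b : FreeMonoid (Fin d)) :
    word Z (a * b) = word Z a * word Z b :=
  map_mul _ a b

theorem word_of (Z : Fin d → Matrix (Fin n) (Fin n) ℂ) (i : Fin d) :
    word Z (FreeMonoid.of i) = Z i :=
  FreeMonoid.lift_eval_of _ _

theorem word_one (Z : Fin d → Matrix (Fin n) (Fin n) ℂ) : word Z 1 = 1 :=
  map_one _

open scoped Matrix.Norms.L2Operator in
theorem exists_sum_vecMul_le (Z : ncBall d n) :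
    ∃ ρ : ℝ, 0 ≤ ρ ∧ ρ < 1 ∧ ∀ v : Fin n → ℂ,
      ∑ i, ∑ k, ‖Matrix.vecMul v (Z.1 i) k‖ ^ 2 ≤ ρ * ∑ k, ‖v k‖ ^ 2 := by
  set M : Matrix (Fin n) (Fin d × Fin n) ℂ := Matrix.of fun i p => Z.1 p.1 i p.2 with hM
  have hZ : ‖M‖ < 1 := Z.2
  refine ⟨‖M‖ ^ 2, by positivity, pow_lt_one₀ (norm_nonneg _) hZ two_ne_zero, fun v => ?_⟩
  -- The entries of `Mᴴ` applied to `star v` are the conjugates of the entries of the row vectors `v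
  -- * Z i`, and `Mᴴ` has the same norm as `M`.
  have h := Matrix.l2_opNorm_mulVec M.conjTranspose (WithLp.toLp 2 (star v))
  rw [Matrix.l2_opNorm_conjTranspose] at h
  have h2 := pow_le_pow_left₀ (norm_nonneg _) h 2
  rw [mul_pow, EuclideanSpace.norm_sq_eq, EuclideanSpace.norm_sq_eq, Fintype.sum_prod_type] at h2
  refine le_of_eq_of_le ?_ (h2.trans_eq ?_)
  · refine Finset.sum_congr rfl fun i _ => Finset.sum_congr rfl fun k _ => ?_
    congr 1
    rw [← norm_star]
    congr 1
    simp [Matrix.vecMul, Matrix.mulVec, dotProduct, hM, mul_comm]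
  · simp

theorem exists_sum_sphere_le (Z : ncBall d n) :
    ∃ ρ : ℝ, 0 ≤ ρ ∧ ρ < 1 ∧ ∀ (m : ℕ) (v : Fin n → ℂ),
      ∑ a ∈ sphere d m, ∑ k, ‖Matrix.vecMul v (word Z.1 a) k‖ ^ 2 ≤ ρ ^ m * ∑ k, ‖v k‖ ^ 2 := by
  obtain ⟨ρ, h0, h1, h⟩ := exists_sum_vecMul_le Z
  refine ⟨ρ, h0, h1, fun m => ?_⟩
  induction m with
  | zero => intro v; simp [sphere, word_one]
  | succ m ih =>
    intro v
    rw [sum_sphere_succ, Finset.sum_comm]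
    simp only [word_of_mul, ← Matrix.vecMul_vecMul]
    refine (Finset.sum_le_sum fun i _ => ih _).trans ?_
    rw [← Finset.mul_sum, pow_succ, mul_assoc]
    exact mul_le_mul_of_nonneg_left (h v) (by positivity)

/-- The kernel vector of the scalar Fock space which represents the evaluation of the `(i, j)`
entry at a point of the ball. -/
def entryVec (Z : ncBall d n) (i j : Fin n) : Fock d ℂ :=
  ⟨fun a => star (word Z.1 a i j), by
    obtain ⟨ρ, h0, h1, h⟩ := exists_sum_sphere_le Z
    refine memℓp_two_of_sum_le (C := (1 - ρ)⁻¹) fun N => ?_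
    rw [sum_wordBall]
    refine (Finset.sum_le_sum (g := fun m => ρ ^ m) fun m _ => ?_).trans ?_
    -- For the `i`-th unit row vector, the product with `Z^a` is row `i` of `Z^a`, so the squared
    -- entries decay geometrically in the length of the word.
    · have := h m (Pi.single i 1)
      rw [Finset.sum_eq_single i (fun k _ hk => by simp [hk]) (by simp)] at this
      simp only [Matrix.single_one_vecMul, Pi.single_eq_same, norm_one, one_pow, mul_one] at this
      refine le_trans (Finset.sum_le_sum fun a _ => ?_) this
      rw [norm_star]
      exact Finset.single_le_sum (f := fun k => ‖(word Z.1 a) i k‖ ^ 2)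
        (fun _ _ => by positivity) (Finset.mem_univ j)
    · rw [← tsum_geometric_of_lt_one h0 h1]
      exact (summable_geometric_of_lt_one h0 h1).sum_le_tsum _ fun _ _ => by positivity⟩

theorem entryVec_apply (Z : ncBall d n) (i j : Fin n) (a : FreeMonoid (Fin d)) :
    entryVec Z i j a = star (word Z.1 a i j) := rfl

/-- The Gram matrix of the kernel vectors, which gives the entries of the Szegő kernel. -/
def gram (Z : ncBall d n) (W : ncBall d m) (i l : Fin n) (j l' : Fin m) : ℂ :=
  inner ℂ (entryVec Z i l) (entryVec W j l')

theorem hasSum_gram (Z : ncBall d n) (W : ncBall d m) (i l : Fin n) (j l' : Fin m) :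
    HasSum (fun a => word Z.1 a i l * star (word W.1 a j l')) (gram Z W i l j l') := by
  refine (lp.hasSum_inner (𝕜 := ℂ) (entryVec Z i l) (entryVec W j l')).congr_fun ?_
  intro a
  simp [entryVec_apply, mul_comm]

/-- Turns the series defining the kernel into a finite combination of inner products of kernel
vectors, for arbitrary coefficients `A`. -/
theorem szego_apply {E : Type*} [NormedAddCommGroup E] [NormedSpace ℂ E]
    (Z : ncBall d n) (W : ncBall d m) (A : Matrix (Fin n) (Fin m) E) (i : Fin n) (j : Fin m) :
    szego Z W A i j = ∑ l, ∑ l', gram Z W i l j l' • A l l' := by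
  refine HasSum.tsum_eq ?_
  have : HasSum (fun a => ∑ l, ∑ l', (word Z.1 a i l * star (word W.1 a j l')) • A l l')
      (∑ l, ∑ l', gram Z W i l j l' • A l l') :=
    hasSum_sum fun l _ => hasSum_sum fun l' _ => (hasSum_gram Z W i l j l').smul_const _
  refine this.congr_fun fun a => ?_
  simp [lact, ract, Finset.smul_sum, smul_smul]

variable {H K : Type*}
  [NormedAddCommGroup H] [InnerProductSpace ℂ H]
  [NormedAddCommGroup K] [InnerProductSpace ℂ K]

theorem sum_norm_entryVec_smul_le (Z : ncBall d n) (i j : Fin n) (x : K) (N : ℕ) :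
    ∑ a ∈ wordBall d N, ‖entryVec Z i j a • x‖ ^ 2 ≤ (‖entryVec Z i j‖ * ‖x‖) ^ 2 := by
  simp only [norm_smul, mul_pow]
  rw [← Finset.sum_mul]
  exact mul_le_mul_of_nonneg_right (sum_norm_sq_le _ N) (by positivity)

/-- The kernel vectors of the `K`-valued Fock space, as an operator on `K`. -/
def kerVec (Z : ncBall d n) (i j : Fin n) : K →L[ℂ] Fock d K :=
  LinearMap.mkContinuous
    { toFun := fun x => ⟨fun a => entryVec Z i j a • x,
        memℓp_two_of_sum_le (sum_norm_entryVec_smul_le Z i j x)⟩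
      map_add' := fun x y => Subtype.ext (funext fun a => smul_add _ x y)
      map_smul' := fun c x => Subtype.ext (funext fun a => smul_comm _ c x) }
    ‖entryVec Z i j‖ fun x =>
      norm_le_of_sum_le (by positivity) (sum_norm_entryVec_smul_le Z i j x)

theorem kerVec_apply (Z : ncBall d n) (i j : Fin n) (x : K) (a : FreeMonoid (Fin d)) :
    kerVec Z i j x a = star (word Z.1 a i j) • x := rfl

theorem inner_kerVec_kerVec (Z : ncBall d n) (W : ncBall d m) (i l : Fin n) (j l' : Fin m)
    (x y : K) :
    inner ℂ (kerVec Z i l x) (kerVec W j l' y) = gram Z W i l j l' * inner ℂ x y := by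
  rw [lp.inner_eq_tsum, ← ((hasSum_gram Z W i l j l').mul_right _).tsum_eq]
  congr 1
  funext a
  rw [kerVec_apply, kerVec_apply, inner_smul_left, inner_smul_right]
  simp [mul_assoc]

variable [CompleteSpace H] [CompleteSpace K]

open scoped Classical in
theorem adjoint_kerVec_single (Z : ncBall d n) (i j : Fin n) (a : FreeMonoid (Fin d)) (x : K) :
    (kerVec Z i j).adjoint (lp.single 2 a x) = word Z.1 a i j • x := by
  refine ext_inner_left ℂ fun y => ?_
  rw [ContinuousLinearMap.adjoint_inner_right, lp.inner_single_right, kerVec_apply,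
    inner_smul_left, inner_smul_right]
  simp

theorem hasSum_hardyFun (Z : ncBall d n) (i j : Fin n) (f : Fock d K) :
    HasSum (fun a => word Z.1 a i j • f a) ((kerVec Z i j).adjoint f) := by
  classical
  have h := lp.hasSum_single (p := 2) (E := fun _ : FreeMonoid (Fin d) => K) (by norm_num) f
  have h2 := ContinuousLinearMap.hasSum (kerVec (K := K) Z i j).adjoint h
  simpa only [adjoint_kerVec_single] using h2

theorem hardyFun_eq_adjoint (f : Fock d K) (Z : ncBall d n) (i j : Fin n) :
    hardyFun f n Z i j = (kerVec Z i j).adjoint f :=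
  (hasSum_hardyFun Z i j f).tsum_eq

theorem inner_kerVec (Z : ncBall d n) (i j : Fin n) (x : K) (f : Fock d K) :
    inner ℂ (kerVec Z i j x) f = inner ℂ x (hardyFun f n Z i j) := by
  rw [hardyFun_eq_adjoint, ContinuousLinearMap.adjoint_inner_right]

theorem isFree_hardyFun (f : Fock d K) : IsFree (hardyFun f) := by
  intro n m Z W X hX
  have hw : ∀ a, word Z.1 a * X = X * word W.1 a := by
    intro a
    induction a using FreeMonoid.inductionOn' with
    | one => simp [word_one]
    | of_mul i a ih => rw [word_of_mul, word_of_mul, Matrix.mul_assoc, ih, ← Matrix.mul_assoc, hX,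
        Matrix.mul_assoc]
  ext i j
  simp only [ract, lact, Matrix.of_apply, hardyFun_eq_adjoint]
  have h1 : HasSum (fun a => ∑ k, X k j • (word Z.1 a i k • f a))
      (∑ k, X k j • (kerVec Z i k).adjoint f) :=
    hasSum_sum fun k _ => (hasSum_hardyFun Z i k f).const_smul _
  have h2 : HasSum (fun a => ∑ k, X i k • (word W.1 a k j • f a))
      (∑ k, X i k • (kerVec W k j).adjoint f) :=
    hasSum_sum fun k _ => (hasSum_hardyFun W k j f).const_smul _
  refine h1.unique (h2.congr_fun fun a => ?_)
  simp only [smul_smul, ← Finset.sum_smul]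
  congr 1
  have := congrFun (congrFun (hw a) i) j
  simp only [Matrix.mul_apply] at this
  rw [← this]
  exact Finset.sum_congr rfl fun k _ => mul_comm _ _

end Evaluation

/-! ### Combinations of kernel vectors and the action of the data -/

section BlockVectors

variable {d N : ℕ} {n : Fin N → ℕ} {H K : Type*}
  [NormedAddCommGroup H] [InnerProductSpace ℂ H] [CompleteSpace H]
  [NormedAddCommGroup K] [InnerProductSpace ℂ K] [CompleteSpace K]

/-- Families of coefficients of kernel vectors. -/
abbrev BlockVec (n : Fin N → ℕ) (K : Type*) : Type _ := ∀ k, Fin (n k) → Fin (n k) → K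

/-- The combination of kernel vectors with given coefficients. -/
def kerSum (Z : ∀ k, ncBall d (n k)) : BlockVec n K →ₗ[ℂ] Fock d K where
  toFun η := ∑ k, ∑ l, ∑ i, kerVec (Z k) i l (η k l i)
  map_add' η θ := by simp [Finset.sum_add_distrib]
  map_smul' c η := by simp [Finset.smul_sum]

omit [CompleteSpace K] in
theorem kerSum_apply (Z : ∀ k, ncBall d (n k)) (η : BlockVec n K) :
    kerSum Z η = ∑ k, ∑ l, ∑ i, kerVec (Z k) i l (η k l i) := rfl

/-- The action of the adjoint of left multiplication on coefficients. -/
def leftAct (W : ∀ k, Matrix (Fin (n k)) (Fin (n k)) (H →L[ℂ] K)) :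
    BlockVec n K →ₗ[ℂ] BlockVec n H where
  toFun η k l s := ∑ i, (W k i s).adjoint (η k l i)
  map_add' η θ := by ext; simp [Finset.sum_add_distrib]
  map_smul' c η := by ext; simp [Finset.smul_sum]

theorem leftAct_apply (W : ∀ k, Matrix (Fin (n k)) (Fin (n k)) (H →L[ℂ] K)) (η : BlockVec n K)
    (k : Fin N) (l s : Fin (n k)) :
    leftAct W η k l s = ∑ i, (W k i s).adjoint (η k l i) := rfl

/-- The action of the adjoint of right multiplication on coefficients. -/
def rightAct (W : ∀ k, Matrix (Fin (n k)) (Fin (n k)) (H →L[ℂ] K)) :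
    BlockVec n K →ₗ[ℂ] BlockVec n H where
  toFun η k s i := ∑ l, (W k s l).adjoint (η k l i)
  map_add' η θ := by ext; simp [Finset.sum_add_distrib]
  map_smul' c η := by ext; simp [Finset.smul_sum]

theorem rightAct_apply (W : ∀ k, Matrix (Fin (n k)) (Fin (n k)) (H →L[ℂ] K)) (η : BlockVec n K)
    (k : Fin N) (s i : Fin (n k)) :
    rightAct W η k s i = ∑ l, (W k s l).adjoint (η k l i) := rfl

end BlockVectors

/-! ### Pick matrices as differences of Gram matrices -/

section PickForms

theorem sum_swap_pairs {α β γ δ E : Type*} [Fintype α] [Fintype β] [Fintype γ] [Fintype δ]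
    [AddCommMonoid E] (f : α → β → γ → δ → E) :
    ∑ a, ∑ b, ∑ c, ∑ e, f a b c e = ∑ c, ∑ e, ∑ a, ∑ b, f a b c e := by
  calc ∑ a, ∑ b, ∑ c, ∑ e, f a b c e
      = ∑ p : α × β, ∑ q : γ × δ, f p.1 p.2 q.1 q.2 := by simp only [Fintype.sum_prod_type]
    _ = ∑ q : γ × δ, ∑ p : α × β, f p.1 p.2 q.1 q.2 := Finset.sum_comm
    _ = _ := by simp only [Fintype.sum_prod_type]

variable {d n m : ℕ} {H K : Type*}
  [NormedAddCommGroup H] [InnerProductSpace ℂ H]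
  [NormedAddCommGroup K] [InnerProductSpace ℂ K]

theorem inner_sum_sum {α β E : Type*} [NormedAddCommGroup E] [InnerProductSpace ℂ E]
    [Fintype α] [Fintype β] (f : α → E) (g : β → E) :
    inner ℂ (∑ i, f i) (∑ j, g j) = ∑ i, ∑ j, inner ℂ (f i) (g j) := by
  rw [sum_inner]
  simp only [inner_sum]

theorem sum_inner_szego_smul (Z : ncBall d n) (Z' : ncBall d m) (P : Matrix (Fin n) (Fin m) ℂ)
    (X : Fin n → K) (Y : Fin m → K) :
    ∑ i, ∑ j, inner ℂ (X i) (szego Z Z' P i j • Y j) =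
      ∑ l, ∑ l', P l l' *
        inner ℂ (∑ i, kerVec Z i l (X i)) (∑ j, kerVec Z' j l' (Y j)) := by
  simp only [inner_sum_sum, inner_kerVec_kerVec]
  simp only [szego_apply, Finset.sum_smul, inner_sum, inner_smul_right, Finset.mul_sum, smul_eq_mul]
  rw [sum_swap_pairs]
  refine Fintype.sum_congr _ _ fun l => Fintype.sum_congr _ _ fun l' =>
    Fintype.sum_congr _ _ fun i => Fintype.sum_congr _ _ fun j => ?_
  ring

variable [CompleteSpace H] [CompleteSpace K]

theorem inner_opMul_tensorId (A : Matrix (Fin n) (Fin n) (H →L[ℂ] K))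
    (B : Matrix (Fin m) (Fin m) (H →L[ℂ] K)) (S : Matrix (Fin n) (Fin m) ℂ) (s : Fin n)
    (t : Fin m) (x y : K) :
    inner ℂ x (opMul (opMul A (tensorId H S)) (opAdj B) s t y) =
      ∑ l, ∑ l', inner ℂ ((A s l).adjoint x) (S l l' • (B t l').adjoint y) := by
  rw [Finset.sum_comm]
  simp [opMul, opAdj, tensorId, ContinuousLinearMap.adjoint_inner_left]

theorem sum_inner_opMul (A : Matrix (Fin n) (Fin n) (H →L[ℂ] K))
    (B : Matrix (Fin m) (Fin m) (H →L[ℂ] K)) (S : Matrix (Fin n) (Fin m) ℂ)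
    (X : Fin n → K) (Y : Fin m → K) :
    ∑ i, ∑ j, inner ℂ (X i) (opMul (opMul A (tensorId H S)) (opAdj B) i j (Y j)) =
      ∑ s, ∑ t, inner ℂ (∑ i, (A i s).adjoint (X i)) (S s t • ∑ j, (B j t).adjoint (Y j)) := by
  simp only [inner_opMul_tensorId, Finset.smul_sum, inner_sum_sum]
  rw [sum_swap_pairs]

theorem sum_inner_szego_opMul (Z : ncBall d n) (Z' : ncBall d m)
    (A : Matrix (Fin n) (Fin n) (H →L[ℂ] K)) (B : Matrix (Fin m) (Fin m) (H →L[ℂ] K))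
    (P : Matrix (Fin n) (Fin m) ℂ) (X : Fin n → K) (Y : Fin m → K) :
    ∑ i, ∑ j, inner ℂ (X i)
        (szego Z Z' (opMul (opMul A (tensorId H P)) (opAdj B)) i j (Y j)) =
      ∑ l, ∑ l', P l l' *
        inner ℂ (∑ i, ∑ s, kerVec Z i s ((A s l).adjoint (X i)))
          (∑ j, ∑ t, kerVec Z' j t ((B t l').adjoint (Y j))) := by
  simp only [inner_sum_sum, inner_kerVec_kerVec]
  simp only [szego_apply, _root_.sum_apply, inner_sum, _root_.smul_apply, inner_smul_right,
    inner_opMul_tensorId, Finset.mul_sum]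
  refine Eq.trans ?_ (sum_swap_pairs _)
  refine Fintype.sum_congr _ _ fun i => Fintype.sum_congr _ _ fun j => ?_
  rw [sum_swap_pairs]
  refine Fintype.sum_congr _ _ fun l => Fintype.sum_congr _ _ fun l' =>
    Fintype.sum_congr _ _ fun s => Fintype.sum_congr _ _ fun t => ?_
  ring

variable {N r : ℕ} {n : Fin N → ℕ}

theorem sum_sum_blocks {E : Type*} [AddCommMonoid E]
    (f : Fin r × (Σ k, Fin (n k)) → Fin r × (Σ k, Fin (n k)) → E) :
    ∑ p, ∑ q, f p q =
      ∑ a, ∑ k, ∑ b, ∑ j, ∑ i, ∑ i', f (a, ⟨k, i⟩) (b, ⟨j, i'⟩) := by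
  simp only [Fintype.sum_prod_type, Fintype.sum_sigma]
  refine Fintype.sum_congr _ _ fun a => Fintype.sum_congr _ _ fun k => ?_
  rw [Finset.sum_comm]
  refine Fintype.sum_congr _ _ fun b => ?_
  rw [Finset.sum_comm]

/-- The partial combinations of kernel vectors which occur in the quadratic form of the Pick
matrices. -/
def kerRow (Z : ∀ k, ncBall d (n k)) (x : Fin r × (Σ k, Fin (n k)) → K)
    (p : Fin r × (Σ k, Fin (n k))) : Fock d K :=
  ∑ i, kerVec (Z p.2.1) i p.2.2 (x (p.1, ⟨p.2.1, i⟩))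

/-- Moving `W k` and `(W j)^*` onto the vectors as adjoints reduces the second term to the form of
the Szegő kernel alone, which is a Gram matrix paired with `P`. -/
theorem leftPick_form (Z : ∀ k, ncBall d (n k))
    (W : ∀ k, Matrix (Fin (n k)) (Fin (n k)) (H →L[ℂ] K))
    (P : Matrix (Fin r × (Σ k, Fin (n k))) (Fin r × (Σ k, Fin (n k))) ℂ)
    (x : Fin r × (Σ k, Fin (n k)) → K) :
    ∑ p, ∑ q, inner ℂ (x p) (amplify (leftPick Z W) r P p q (x q)) =
      ∑ p, ∑ q, P p q * (inner ℂ (kerRow Z x p) (kerRow Z x q) -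
        inner ℂ (kerRow Z (fun p => ∑ i, (W p.2.1 i p.2.2).adjoint (x (p.1, ⟨p.2.1, i⟩))) p)
          (kerRow Z (fun p => ∑ i, (W p.2.1 i p.2.2).adjoint (x (p.1, ⟨p.2.1, i⟩))) q)) := by
  rw [sum_sum_blocks, sum_sum_blocks]
  refine Fintype.sum_congr _ _ fun a => Fintype.sum_congr _ _ fun k =>
    Fintype.sum_congr _ _ fun b => Fintype.sum_congr _ _ fun j => ?_
  simp only [amplify, leftPick, Matrix.of_apply, Matrix.sub_apply, _root_.sub_apply,
    inner_sub_right, mul_sub, Finset.sum_sub_distrib]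
  congr 1
  · exact sum_inner_szego_smul (Z k) (Z j) (block (Matrix.of fun p q => P (a, p) (b, q)) k j)
      (fun i => x (a, ⟨k, i⟩)) (fun i => x (b, ⟨j, i⟩))
  · refine (sum_inner_opMul (W k) (W j) _ (fun i => x (a, ⟨k, i⟩)) (fun i => x (b, ⟨j, i⟩))).trans ?_
    exact sum_inner_szego_smul (Z k) (Z j) (block (Matrix.of fun p q => P (a, p) (b, q)) k j)
      (fun s => ∑ i, (W k i s).adjoint (x (a, ⟨k, i⟩)))
      (fun s => ∑ i, (W j i s).adjoint (x (b, ⟨j, i⟩)))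

/-- The counterpart of `kerRow` for the right multiplication by the adjoint of the data. -/
def rightRow (Z : ∀ k, ncBall d (n k))
    (W : ∀ k, Matrix (Fin (n k)) (Fin (n k)) (H →L[ℂ] K))
    (x : Fin r × (Σ k, Fin (n k)) → K) (p : Fin r × (Σ k, Fin (n k))) : Fock d H :=
  ∑ i, ∑ s, kerVec (Z p.2.1) i s ((W p.2.1 s p.2.2).adjoint (x (p.1, ⟨p.2.1, i⟩)))

theorem rightPick_form (Z : ∀ k, ncBall d (n k))
    (W : ∀ k, Matrix (Fin (n k)) (Fin (n k)) (H →L[ℂ] K))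
    (P : Matrix (Fin r × (Σ k, Fin (n k))) (Fin r × (Σ k, Fin (n k))) ℂ)
    (x : Fin r × (Σ k, Fin (n k)) → K) :
    ∑ p, ∑ q, inner ℂ (x p) (amplify (rightPick Z W) r P p q (x q)) =
      ∑ p, ∑ q, P p q * (inner ℂ (kerRow Z x p) (kerRow Z x q) -
        inner ℂ (rightRow Z W x p) (rightRow Z W x q)) := by
  rw [sum_sum_blocks, sum_sum_blocks]
  refine Fintype.sum_congr _ _ fun a => Fintype.sum_congr _ _ fun k =>
    Fintype.sum_congr _ _ fun b => Fintype.sum_congr _ _ fun j => ?_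
  simp only [amplify, rightPick, Matrix.of_apply, Matrix.sub_apply, _root_.sub_apply,
    inner_sub_right, mul_sub, Finset.sum_sub_distrib]
  congr 1
  · exact sum_inner_szego_smul (Z k) (Z j) (block (Matrix.of fun p q => P (a, p) (b, q)) k j)
      (fun i => x (a, ⟨k, i⟩)) (fun i => x (b, ⟨j, i⟩))
  · exact sum_inner_szego_opMul (Z k) (Z j) (W k) (W j)
      (block (Matrix.of fun p q => P (a, p) (b, q)) k j)
      (fun i => x (a, ⟨k, i⟩)) (fun i => x (b, ⟨j, i⟩))

end PickForms

/-! ### Positivity through rank-one matrices -/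

section Positivity

theorem sum_rankOne {ι E F : Type*} [Fintype ι]
    [NormedAddCommGroup E] [InnerProductSpace ℂ E] [NormedAddCommGroup F] [InnerProductSpace ℂ F]
    (κ : ι → E) (μ : ι → F) (c : ι → ℂ) :
    ∑ p, ∑ q, star (c p) * c q * (inner ℂ (κ p) (κ q) - inner ℂ (μ p) (μ q)) =
      ((‖∑ p, c p • κ p‖ ^ 2 - ‖∑ p, c p • μ p‖ ^ 2 : ℝ) : ℂ) := by
  have hE : ∀ x : E, ((‖x‖ ^ 2 : ℝ) : ℂ) = inner ℂ x x := fun x => by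
    rw [inner_self_eq_norm_sq_to_K]; simp
  have hF : ∀ x : F, ((‖x‖ ^ 2 : ℝ) : ℂ) = inner ℂ x x := fun x => by
    rw [inner_self_eq_norm_sq_to_K]; simp
  rw [Complex.ofReal_sub, hE, hF, inner_sum_sum, inner_sum_sum, ← Finset.sum_sub_distrib]
  refine Fintype.sum_congr _ _ fun p => ?_
  rw [← Finset.sum_sub_distrib]
  refine Fintype.sum_congr _ _ fun q => ?_
  simp only [inner_smul_left, inner_smul_right, starRingEnd_apply]
  ring

-- Writing `P` as `star C * C` splits it into rank-one matrices, one for each row of `C`, and `h`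
-- applies to each row.
open scoped MatrixOrder Matrix.Norms.L2Operator in
theorem sum_posSemidef_nonneg {ι E F : Type*} [Fintype ι]
    [NormedAddCommGroup E] [InnerProductSpace ℂ E] [NormedAddCommGroup F] [InnerProductSpace ℂ F]
    (κ : ι → E) (μ : ι → F) (h : ∀ c : ι → ℂ, ‖∑ p, c p • μ p‖ ≤ ‖∑ p, c p • κ p‖)
    {P : Matrix ι ι ℂ} (hP : P.PosSemidef) :
    0 ≤ ∑ p, ∑ q, P p q * (inner ℂ (κ p) (κ q) - inner ℂ (μ p) (μ q)) := by
  classical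
  obtain ⟨C, rfl⟩ := CStarAlgebra.nonneg_iff_eq_star_mul_self.1 hP.nonneg
  have : ∑ p, ∑ q, (star C * C) p q * (inner ℂ (κ p) (κ q) - inner ℂ (μ p) (μ q)) =
      ∑ t, ∑ p, ∑ q, star (C t p) * C t q * (inner ℂ (κ p) (κ q) - inner ℂ (μ p) (μ q)) := by
    simp only [Matrix.star_eq_conjTranspose, Matrix.mul_apply, Matrix.conjTranspose_apply, Finset.sum_mul]
    rw [Finset.sum_comm_cycle]
  rw [this]
  refine Finset.sum_nonneg fun t _ => ?_
  rw [sum_rankOne, Complex.zero_le_real, sub_nonneg]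
  exact pow_le_pow_left₀ (norm_nonneg _) (h _) 2

end Positivity

/-! ### Complete positivity as a norm inequality -/

section CompletePositivity

variable {d N : ℕ} {n : Fin N → ℕ} {H K : Type*}
  [NormedAddCommGroup H] [InnerProductSpace ℂ H] [CompleteSpace H]
  [NormedAddCommGroup K] [InnerProductSpace ℂ K] [CompleteSpace K]

/-- The coefficients obtained by contracting amplified vectors with scalars. -/
def contract {r : ℕ} (c : Fin r × (Σ k, Fin (n k)) → ℂ) (x : Fin r × (Σ k, Fin (n k)) → K) :
    BlockVec n K :=
  fun k l i => ∑ a, c (a, ⟨k, l⟩) • x (a, ⟨k, i⟩)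

omit [CompleteSpace K] in
theorem exists_contract (η : BlockVec n K) :
    ∃ (r : ℕ) (c : Fin r × (Σ k, Fin (n k)) → ℂ) (x : Fin r × (Σ k, Fin (n k)) → K),
      contract c x = η := by
  have hr : ∀ k, n k ≤ ∑ k, n k := fun k =>
    Finset.single_le_sum (f := n) (fun _ _ => Nat.zero_le _) (Finset.mem_univ k)
  -- The amplification index plays the role of the column index `l`, selected by a Kronecker delta.
  -- The order `∑ k, n k` is at least every `n k`, and columns beyond the size of a block are filled
  -- with zero.
  refine ⟨∑ k, n k, fun p => if (p.1 : ℕ) = p.2.2 then 1 else 0,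
    fun p => if h : (p.1 : ℕ) < n p.2.1 then η p.2.1 ⟨p.1, h⟩ p.2.2 else 0, ?_⟩
  funext k l i
  rw [contract, Finset.sum_eq_single (Fin.castLE (hr k) l)]
  · simp
  · intro a _ ha
    have : ¬ (a : ℕ) = l := fun h => ha (Fin.ext h)
    simp [this]
  · simp

omit [CompleteSpace K] in
theorem sum_smul_kerRow (Z : ∀ k, ncBall d (n k)) {r : ℕ}
    (c : Fin r × (Σ k, Fin (n k)) → ℂ) (x : Fin r × (Σ k, Fin (n k)) → K) :
    ∑ p, c p • kerRow Z x p = kerSum Z (contract c x) := by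
  simp only [kerRow, kerSum_apply, contract, Fintype.sum_prod_type, Fintype.sum_sigma, map_sum,
    map_smul, Finset.smul_sum]
  rw [Finset.sum_comm]
  refine Fintype.sum_congr _ _ fun k => ?_
  rw [Finset.sum_comm]
  refine Fintype.sum_congr _ _ fun l => ?_
  rw [Finset.sum_comm]

theorem contract_leftAct (W : ∀ k, Matrix (Fin (n k)) (Fin (n k)) (H →L[ℂ] K)) {r : ℕ}
    (c : Fin r × (Σ k, Fin (n k)) → ℂ) (x : Fin r × (Σ k, Fin (n k)) → K) :
    contract c (fun p => ∑ i, (W p.2.1 i p.2.2).adjoint (x (p.1, ⟨p.2.1, i⟩))) =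
      leftAct W (contract c x) := by
  funext k l s
  simp only [contract, leftAct_apply, map_sum, map_smul, Finset.smul_sum]
  rw [Finset.sum_comm]

theorem sum_smul_rightRow (Z : ∀ k, ncBall d (n k))
    (W : ∀ k, Matrix (Fin (n k)) (Fin (n k)) (H →L[ℂ] K)) {r : ℕ}
    (c : Fin r × (Σ k, Fin (n k)) → ℂ) (x : Fin r × (Σ k, Fin (n k)) → K) :
    ∑ p, c p • rightRow Z W x p = kerSum Z (rightAct W (contract c x)) := by
  simp only [rightRow, kerSum_apply, rightAct_apply, contract, Fintype.sum_prod_type,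
    Fintype.sum_sigma, map_sum, map_smul, Finset.smul_sum]
  rw [Finset.sum_comm]
  refine Fintype.sum_congr _ _ fun k => ?_
  rw [sum_swap_pairs, Finset.sum_comm]
  refine Fintype.sum_congr _ _ fun s => Fintype.sum_congr _ _ fun i => ?_
  rw [Finset.sum_comm]

-- Rank-one `P` already test every `η`, by `exists_contract`; conversely the inequality on all `η`
-- gives positivity for every `P`. Abstracting `act` and `row` serves both sides at once.
omit [CompleteSpace H] [CompleteSpace K] in
theorem completelyPositive_iff (Z : ∀ k, ncBall d (n k))
    (Φ : Matrix (Σ k, Fin (n k)) (Σ k, Fin (n k)) ℂ →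
      Matrix (Σ k, Fin (n k)) (Σ k, Fin (n k)) (K →L[ℂ] K))
    (act : BlockVec n K → BlockVec n H)
    (row : ∀ r : ℕ, (Fin r × (Σ k, Fin (n k)) → K) → Fin r × (Σ k, Fin (n k)) → Fock d H)
    (hrow : ∀ r c x, ∑ p, c p • row r x p = kerSum Z (act (contract c x)))
    (hΦ : ∀ r P x, ∑ p, ∑ q, inner ℂ (x p) (amplify Φ r P p q (x q)) =
      ∑ p, ∑ q, P p q * (inner ℂ (kerRow Z x p) (kerRow Z x q) -
        inner ℂ (row r x p) (row r x q))) :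
    CompletelyPositive Φ ↔ ∀ η, ‖kerSum Z (act η)‖ ≤ ‖kerSum Z η‖ := by
  constructor
  · intro h η
    obtain ⟨r, c, x, rfl⟩ := exists_contract η
    have h1 := h r (Matrix.vecMulVec (star c) c) (Matrix.posSemidef_vecMulVec_star_self c) x
    rw [hΦ] at h1
    simp only [Matrix.vecMulVec_apply, Pi.star_apply] at h1
    rw [sum_rankOne, Complex.zero_le_real, sub_nonneg, sum_smul_kerRow, hrow] at h1
    exact (sq_le_sq₀ (norm_nonneg _) (norm_nonneg _)).1 h1
  · intro h r P hP x
    rw [hΦ]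
    refine sum_posSemidef_nonneg _ _ (fun c => ?_) hP
    rw [sum_smul_kerRow, hrow]
    exact h _

theorem completelyPositive_leftPick_iff (Z : ∀ k, ncBall d (n k))
    (W : ∀ k, Matrix (Fin (n k)) (Fin (n k)) (H →L[ℂ] K)) :
    CompletelyPositive (leftPick Z W) ↔ ∀ η, ‖kerSum Z (leftAct W η)‖ ≤ ‖kerSum Z η‖ :=
  completelyPositive_iff Z _ (leftAct W)
    (fun _ x => kerRow Z fun p => ∑ i, (W p.2.1 i p.2.2).adjoint (x (p.1, ⟨p.2.1, i⟩)))
    (fun _ c x => by rw [sum_smul_kerRow, contract_leftAct]) fun _ P x => leftPick_form Z W P x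

theorem completelyPositive_rightPick_iff (Z : ∀ k, ncBall d (n k))
    (W : ∀ k, Matrix (Fin (n k)) (Fin (n k)) (H →L[ℂ] K)) :
    CompletelyPositive (rightPick Z W) ↔ ∀ η, ‖kerSum Z (rightAct W η)‖ ≤ ‖kerSum Z η‖ :=
  completelyPositive_iff Z _ (rightAct W) (fun _ x => rightRow Z W x)
    (fun _ c x => sum_smul_rightRow Z W c x) fun _ P x => rightPick_form Z W P x

end CompletePositivity

/-! ### Reversal of words -/

section Reversal

variable {d : ℕ} {H K : Type*}
  [NormedAddCommGroup H] [InnerProductSpace ℂ H]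
  [NormedAddCommGroup K] [InnerProductSpace ℂ K]

theorem reverse_bijective :
    Function.Bijective (FreeMonoid.reverse : FreeMonoid (Fin d) → FreeMonoid (Fin d)) :=
  Function.Involutive.bijective fun _ => FreeMonoid.reverse_reverse

/-- The reversal of words as an isometry of the Fock space. -/
def reversal (d : ℕ) (K : Type*) [NormedAddCommGroup K] [InnerProductSpace ℂ K] :
    Fock d K →ₗᵢ[ℂ] Fock d K where
  toFun f := ⟨fun a => f a.reverse, memℓp_gen (p := 2) (by
    simpa [Function.comp_def] using
      (hasSum_norm_sq f).summable.comp_injective reverse_bijective.injective)⟩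
  map_add' _ _ := rfl
  map_smul' _ _ := rfl
  norm_map' f := by
    rw [← sq_eq_sq₀ (norm_nonneg _) (norm_nonneg _)]
    exact (hasSum_norm_sq _).unique
      ((Equiv.ofBijective _ reverse_bijective).hasSum_iff.2 (hasSum_norm_sq f))

theorem reversal_apply (f : Fock d K) (a : FreeMonoid (Fin d)) :
    reversal d K f a = f a.reverse := rfl

theorem reversal_reversal (f : Fock d K) : reversal d K (reversal d K f) = f := by
  ext a
  rw [reversal_apply, reversal_apply, FreeMonoid.reverse_reverse]

open scoped Classical in
theorem reversal_single (g : FreeMonoid (Fin d)) (h : K) :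
    reversal d K (lp.single 2 g h) = lp.single 2 g.reverse h := by
  ext a
  rw [reversal_apply, lp.single_apply, lp.single_apply]
  by_cases ha : a = g.reverse
  · rw [ha, FreeMonoid.reverse_reverse, Pi.single_eq_same, Pi.single_eq_same]
  · rw [Pi.single_eq_of_ne ha, Pi.single_eq_of_ne]
    rintro rfl
    exact ha FreeMonoid.reverse_reverse.symm

open scoped Classical in
/-- Commutant lifting for the left backward shifts. -/
theorem exists_lift_reverse [CompleteSpace H] [CompleteSpace K] {V : Type*} [AddCommGroup V]
    [Module ℂ V] (R : Fin d → V →ₗ[ℂ] V) (LK : V →ₗ[ℂ] Fock d K) (LH : V →ₗ[ℂ] Fock d H)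
    (hK : ∀ i v a, LK (R i v) a = LK v (FreeMonoid.of i * a))
    (hH : ∀ i v a, LH (R i v) a = LH v (FreeMonoid.of i * a))
    (hle : ∀ v, ‖LH v‖ ≤ ‖LK v‖) :
    ∃ F : Fock d H →L[ℂ] Fock d K, (∀ u, ‖F u‖ ≤ ‖u‖) ∧
      (∀ g h b, F (lp.single 2 g h) (g * b) = F (lp.single 2 1 h) b) ∧
      (∀ g h a, (∀ b, a ≠ g * b) → F (lp.single 2 g h) a = 0) ∧
      ∀ v u, inner ℂ (LK v) (F u) = inner ℂ (LH v) u := by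
  -- Reversal exchanges the first and last letters of a word, so conjugation by it carries one
  -- family of backward shifts to the other.
  obtain ⟨F, h1, h2, h3, h4⟩ := exists_lift R ((reversal d K).toLinearMap ∘ₗ LK)
    ((reversal d H).toLinearMap ∘ₗ LH)
    (fun i v a => (hK i v _).trans (by
      simp [reversal_apply, FreeMonoid.reverse_mul]))
    (fun i v a => (hH i v _).trans (by
      simp [reversal_apply, FreeMonoid.reverse_mul]))
    (fun v => by simpa using hle v)
  refine ⟨(reversal d K).toContinuousLinearMap.comp
    (F.comp (reversal d H).toContinuousLinearMap), fun u => ?_, fun g h b => ?_,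
    fun g h a ha => ?_, fun v u => ?_⟩
  · simpa using h1 (reversal d H u)
  · simp [reversal_apply, reversal_single, FreeMonoid.reverse_mul, h2]
    rfl
  · simp only [ContinuousLinearMap.comp_apply, LinearIsometry.coe_toContinuousLinearMap,
      reversal_single, reversal_apply]
    refine h3 _ _ _ fun b hb => ha b.reverse ?_
    rw [← FreeMonoid.reverse_reverse (a := a), hb, FreeMonoid.reverse_mul,
      FreeMonoid.reverse_reverse]
  · have := h4 v (reversal d H u)
    simp only [LinearMap.comp_apply, LinearIsometry.coe_toLinearMap,
      LinearIsometry.inner_map_map] at this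
    rw [← this]
    simp only [ContinuousLinearMap.comp_apply, LinearIsometry.coe_toContinuousLinearMap]
    rw [← (reversal d K).inner_map_map (LK v), reversal_reversal]

end Reversal

/-! ### Shift-invariant operators are multiplications -/

section Multipliers

variable {d : ℕ} {H K : Type*}
  [NormedAddCommGroup H] [InnerProductSpace ℂ H] [CompleteSpace H]
  [NormedAddCommGroup K] [InnerProductSpace ℂ K] [CompleteSpace K]

open scoped Classical in
/-- The graded function whose coefficients are given by the action of a multiplier on constants. -/
def symbol (F : Fock d H →L[ℂ] Fock d K) : GradedFun d (H →L[ℂ] K) :=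
  fun _ Z => Matrix.of fun i j =>
    (kerVec Z i j).adjoint.comp
      (F.comp (lp.singleContinuousLinearMap ℂ (fun _ : FreeMonoid (Fin d) => H) 2 1))

omit [CompleteSpace H] in
open scoped Classical in
theorem symbol_apply (F : Fock d H →L[ℂ] Fock d K) {n : ℕ} (Z : ncBall d n) (i j : Fin n)
    (h : H) : symbol F n Z i j h = hardyFun (F (lp.single 2 1 h)) n Z i j := by
  rw [hardyFun_eq_adjoint]
  rfl

omit [CompleteSpace H] in
theorem isFree_symbol (F : Fock d H →L[ℂ] Fock d K) : IsFree (symbol F) := by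
  classical
  intro n m Z W X hX
  ext i j h
  have := congrFun (congrFun (isFree_hardyFun (F (lp.single 2 1 h)) n m Z W X hX) i) j
  simpa [ract, lact, symbol_apply] using this

open scoped Classical in
theorem hardyFun_single_one {n : ℕ} (Z : ncBall d n) (i j : Fin n) (h : H) :
    hardyFun (lp.single 2 1 h : Fock d H) n Z i j = if i = j then h else 0 := by
  rw [hardyFun_eq_adjoint, adjoint_kerVec_single, word_one, Matrix.one_apply]
  split_ifs <;> simp

-- By continuity it suffices to test on single words `g`. There `h1` and `h2` say that `F` appends
-- `g` to the words in its response to a constant, and `Z^(bg) = Z^b Z^g` makes this multiplication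
-- by the symbol on the left.
open scoped Classical in
theorem hardyFun_eq_leftProd (F : Fock d H →L[ℂ] Fock d K)
    (h1 : ∀ g h b, F (lp.single 2 g h) (b * g) = F (lp.single 2 1 h) b)
    (h2 : ∀ g h a, (∀ b, a ≠ b * g) → F (lp.single 2 g h) a = 0)
    (f : Fock d H) (n : ℕ) (Z : ncBall d n) :
    hardyFun (F f) n Z = leftProd (symbol F n Z) (hardyFun f n Z) := by
  ext i j
  have key : (kerVec Z i j).adjoint.comp F =
      ∑ k, (symbol F n Z i k).comp (kerVec Z k j).adjoint := by
    refine lp.ext_continuousLinearMap (by norm_num) fun g => ?_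
    ext h
    simp only [ContinuousLinearMap.comp_apply, _root_.sum_apply,
      lp.singleContinuousLinearMap_apply, adjoint_kerVec_single, map_smul, symbol_apply,
      hardyFun_eq_adjoint]
    have hs := hasSum_hardyFun Z i j (F (lp.single 2 g h))
    -- Only words ending in `g` contribute, so the series is reindexed by their remaining prefixes
    -- `b`.
    rw [← (mul_left_injective g).hasSum_iff] at hs
    · refine hs.unique ?_
      refine (hasSum_sum fun k _ => (hasSum_hardyFun Z i k
        (F (lp.single 2 1 h))).const_smul (word Z.1 g k j)).congr_fun fun b => ?_
      simp only [Function.comp_apply, h1, word_mul, Matrix.mul_apply, smul_smul, ← Finset.sum_smul]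
      congr 1
      exact Finset.sum_congr rfl fun k _ => mul_comm _ _
    · intro a ha
      rw [h2 g h a fun b hb => ha ⟨b, hb.symm⟩, smul_zero]
  have := DFunLike.congr_fun key f
  simpa [leftProd, hardyFun_eq_adjoint] using this

open scoped Classical in
theorem hardyFun_eq_rightProd (F : Fock d H →L[ℂ] Fock d K)
    (h1 : ∀ g h b, F (lp.single 2 g h) (g * b) = F (lp.single 2 1 h) b)
    (h2 : ∀ g h a, (∀ b, a ≠ g * b) → F (lp.single 2 g h) a = 0)
    (f : Fock d H) (n : ℕ) (Z : ncBall d n) :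
    hardyFun (F f) n Z = rightProd (symbol F n Z) (hardyFun f n Z) := by
  ext i j
  have key : (kerVec Z i j).adjoint.comp F =
      ∑ k, (symbol F n Z k j).comp (kerVec Z i k).adjoint := by
    refine lp.ext_continuousLinearMap (by norm_num) fun g => ?_
    ext h
    simp only [ContinuousLinearMap.comp_apply, _root_.sum_apply,
      lp.singleContinuousLinearMap_apply, adjoint_kerVec_single, map_smul, symbol_apply,
      hardyFun_eq_adjoint]
    have hs := hasSum_hardyFun Z i j (F (lp.single 2 g h))
    rw [← (mul_right_injective g).hasSum_iff] at hs
    · refine hs.unique ?_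
      refine (hasSum_sum fun k _ => (hasSum_hardyFun Z k j
        (F (lp.single 2 1 h))).const_smul (word Z.1 g i k)).congr_fun fun b => ?_
      simp only [Function.comp_apply, h1, word_mul, Matrix.mul_apply, smul_smul, ← Finset.sum_smul]
    · intro a ha
      rw [h2 g h a fun b hb => ha ⟨b, hb.symm⟩, smul_zero]
  have := DFunLike.congr_fun key f
  simpa [rightProd, hardyFun_eq_adjoint] using this

end Multipliers

/-! ### Interpolation from the norm inequalities -/

section Interpolation

variable {d N : ℕ} {n : Fin N → ℕ} {H K : Type*}
  [NormedAddCommGroup H] [InnerProductSpace ℂ H] [CompleteSpace H]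
  [NormedAddCommGroup K] [InnerProductSpace ℂ K] [CompleteSpace K]

theorem inner_kerSum (Z : ∀ k, ncBall d (n k)) (η : BlockVec n K) (f : Fock d K) :
    inner ℂ (kerSum Z η) f = ∑ k, ∑ l, ∑ i, inner ℂ (η k l i) (hardyFun f (n k) (Z k) i l) := by
  simp only [kerSum_apply, sum_inner, inner_kerVec]

theorem inner_kerSum_leftAct (Z : ∀ k, ncBall d (n k))
    (W : ∀ k, Matrix (Fin (n k)) (Fin (n k)) (H →L[ℂ] K)) (η : BlockVec n K) (f : Fock d H) :
    inner ℂ (kerSum Z (leftAct W η)) f =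
      ∑ k, ∑ l, ∑ i, inner ℂ (η k l i) (leftProd (W k) (hardyFun f (n k) (Z k)) i l) := by
  simp only [inner_kerSum, leftAct_apply, leftProd, Matrix.of_apply, sum_inner, inner_sum,
    ContinuousLinearMap.adjoint_inner_left]
  refine Fintype.sum_congr _ _ fun k => Fintype.sum_congr _ _ fun l => ?_
  rw [Finset.sum_comm]

theorem inner_kerSum_rightAct (Z : ∀ k, ncBall d (n k))
    (W : ∀ k, Matrix (Fin (n k)) (Fin (n k)) (H →L[ℂ] K)) (η : BlockVec n K) (f : Fock d H) :
    inner ℂ (kerSum Z (rightAct W η)) f =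
      ∑ k, ∑ l, ∑ i, inner ℂ (η k l i) (rightProd (W k) (hardyFun f (n k) (Z k)) i l) := by
  simp only [inner_kerSum, rightAct_apply, rightProd, Matrix.of_apply, sum_inner, inner_sum,
    ContinuousLinearMap.adjoint_inner_left]
  refine Fintype.sum_congr _ _ fun k => ?_
  rw [Finset.sum_comm, Finset.sum_comm_cycle]

omit [CompleteSpace K] in
theorem eq_of_sum_inner_eq {X Y : ∀ k, Matrix (Fin (n k)) (Fin (n k)) K}
    (h : ∀ η : BlockVec n K, ∑ k, ∑ l, ∑ i, inner ℂ (η k l i) (X k i l) =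
      ∑ k, ∑ l, ∑ i, inner ℂ (η k l i) (Y k i l)) : X = Y := by
  -- Coefficients carry the column index first, hence the transposed order.
  have h1 := h fun k l i => X k i l - Y k i l
  rw [← sub_eq_zero] at h1
  simp only [← Finset.sum_sub_distrib, ← inner_sub_right] at h1
  have h2 := congrArg Complex.re h1
  simp only [Complex.re_sum, Complex.zero_re] at h2
  have h3 : ∀ k l i, 0 ≤ (inner ℂ (X k i l - Y k i l) (X k i l - Y k i l)).re :=
    fun k l i => inner_self_nonneg (𝕜 := ℂ)
  funext k
  ext i l
  rw [Finset.sum_eq_zero_iff_of_nonneg fun k _ => Finset.sum_nonneg fun l _ =>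
    Finset.sum_nonneg fun i _ => h3 k l i] at h2
  have h4 := h2 k (Finset.mem_univ k)
  rw [Finset.sum_eq_zero_iff_of_nonneg fun l _ => Finset.sum_nonneg fun i _ => h3 k l i] at h4
  have h5 := h4 l (Finset.mem_univ l)
  rw [Finset.sum_eq_zero_iff_of_nonneg fun i _ => h3 k l i] at h5
  have h6 := h5 i (Finset.mem_univ i)
  exact sub_eq_zero.1 ((re_inner_self_nonpos (𝕜 := ℂ)).1 h6.le)

/-- Cauchy–Schwarz gives `‖f‖² ≤ ‖e‖ ‖g‖ ≤ ‖e‖ ‖f‖`. With `g` the product of the multiplier with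
`f`, this bounds the adjoint of multiplication without constructing multiplication as an operator.
-/
theorem norm_le_of_inner_eq {E F : Type*} [NormedAddCommGroup E] [InnerProductSpace ℂ E]
    [NormedAddCommGroup F] [InnerProductSpace ℂ F] {e g : E} {f : F}
    (hg : ‖g‖ ≤ ‖f‖) (h : inner ℂ e g = inner ℂ f f) : ‖f‖ ≤ ‖e‖ := by
  have h1 : ‖f‖ * ‖f‖ ≤ ‖f‖ * ‖e‖ := by
    rw [← inner_self_eq_norm_mul_norm (𝕜 := ℂ) f, ← h, mul_comm]
    exact (re_inner_le_norm e g).trans (mul_le_mul_of_nonneg_left hg (norm_nonneg _))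
  rcases (norm_nonneg f).eq_or_lt with h0 | h0
  · rw [← h0]
    exact norm_nonneg _
  · exact le_of_mul_le_mul_left h1 h0

theorem norm_kerSum_leftAct_le (Z : ∀ k, ncBall d (n k))
    (W : ∀ k, Matrix (Fin (n k)) (Fin (n k)) (H →L[ℂ] K)) (B : GradedFun d (H →L[ℂ] K))
    (hB : B ∈ leftSchur d H K) (hW : ∀ k, B (n k) (Z k) = W k) (η : BlockVec n K) :
    ‖kerSum Z (leftAct W η)‖ ≤ ‖kerSum Z η‖ := by
  -- The multiplier is tested on the very vector whose norm is to be bounded.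
  obtain ⟨g, hg, hBg⟩ := hB.2 (kerSum Z (leftAct W η))
  refine norm_le_of_inner_eq hg ?_
  simp only [inner_kerSum_leftAct, inner_kerSum Z η, hBg, hW]

theorem norm_kerSum_rightAct_le (Z : ∀ k, ncBall d (n k))
    (W : ∀ k, Matrix (Fin (n k)) (Fin (n k)) (H →L[ℂ] K)) (B : GradedFun d (H →L[ℂ] K))
    (hB : B ∈ rightSchur d H K) (hW : ∀ k, B (n k) (Z k) = W k) (η : BlockVec n K) :
    ‖kerSum Z (rightAct W η)‖ ≤ ‖kerSum Z η‖ := by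
  obtain ⟨g, hg, hBg⟩ := hB.2 (kerSum Z (rightAct W η))
  refine norm_le_of_inner_eq hg ?_
  simp only [inner_kerSum_rightAct, inner_kerSum Z η, hBg, hW]

/-- The action on coefficients of the adjoint of multiplication by a coordinate on the right. -/
def rightShift (Z : ∀ k, ncBall d (n k)) (j : Fin d) : BlockVec n K →ₗ[ℂ] BlockVec n K where
  toFun η k q i := ∑ l, star ((Z k).1 j q l) • η k l i
  map_add' η θ := by ext; simp [Finset.sum_add_distrib]
  map_smul' c η := by
    ext
    simp only [Pi.smul_apply, Finset.smul_sum, RingHom.id_apply]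
    exact Finset.sum_congr rfl fun _ _ => smul_comm _ _ _

/-- The action on coefficients of the adjoint of multiplication by a coordinate on the left. -/
def leftShift (Z : ∀ k, ncBall d (n k)) (j : Fin d) : BlockVec n K →ₗ[ℂ] BlockVec n K where
  toFun η k l q := ∑ i, star ((Z k).1 j i q) • η k l i
  map_add' η θ := by ext; simp [Finset.sum_add_distrib]
  map_smul' c η := by
    ext
    simp only [Pi.smul_apply, Finset.smul_sum, RingHom.id_apply]
    exact Finset.sum_congr rfl fun _ _ => smul_comm _ _ _

omit [CompleteSpace K] in
theorem rightShift_apply (Z : ∀ k, ncBall d (n k)) (j : Fin d) (η : BlockVec n K) (k : Fin N)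
    (q i : Fin (n k)) : rightShift Z j η k q i = ∑ l, star ((Z k).1 j q l) • η k l i := rfl

omit [CompleteSpace K] in
theorem leftShift_apply (Z : ∀ k, ncBall d (n k)) (j : Fin d) (η : BlockVec n K) (k : Fin N)
    (l q : Fin (n k)) : leftShift Z j η k l q = ∑ i, star ((Z k).1 j i q) • η k l i := rfl

omit [CompleteSpace K] in
theorem kerSum_coeff (Z : ∀ k, ncBall d (n k)) (η : BlockVec n K) (a : FreeMonoid (Fin d)) :
    kerSum Z η a = ∑ k, ∑ l, ∑ i, star (word (Z k).1 a i l) • η k l i := by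
  rw [← coeff_apply, kerSum_apply]
  simp only [map_sum, coeff_apply, kerVec_apply]

omit [CompleteSpace K] in
theorem kerSum_rightShift (Z : ∀ k, ncBall d (n k)) (j : Fin d) (η : BlockVec n K)
    (a : FreeMonoid (Fin d)) :
    kerSum Z (rightShift Z j η) a = kerSum Z η (a * FreeMonoid.of j) := by
  simp only [kerSum_coeff, rightShift_apply, word_mul, word_of, Matrix.mul_apply, star_sum,
    star_mul', Finset.sum_smul, Finset.smul_sum, smul_smul]
  refine Fintype.sum_congr _ _ fun k => ?_
  rw [Finset.sum_comm_cycle]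
  refine Fintype.sum_congr _ _ fun l => ?_
  rw [Finset.sum_comm]

omit [CompleteSpace K] in
theorem kerSum_leftShift (Z : ∀ k, ncBall d (n k)) (j : Fin d) (η : BlockVec n K)
    (a : FreeMonoid (Fin d)) :
    kerSum Z (leftShift Z j η) a = kerSum Z η (FreeMonoid.of j * a) := by
  simp only [kerSum_coeff, leftShift_apply, word_of_mul, Matrix.mul_apply, star_sum,
    star_mul', Finset.sum_smul, Finset.smul_sum, smul_smul]
  refine Fintype.sum_congr _ _ fun k => Fintype.sum_congr _ _ fun l => ?_
  rw [Finset.sum_comm]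
  refine Fintype.sum_congr _ _ fun i => Fintype.sum_congr _ _ fun q => ?_
  rw [mul_comm]

/-- The data act on the row index and the shift on the column index, so they commute with no
relation between `W` and `Z`. -/
theorem leftAct_rightShift (Z : ∀ k, ncBall d (n k))
    (W : ∀ k, Matrix (Fin (n k)) (Fin (n k)) (H →L[ℂ] K)) (j : Fin d) (η : BlockVec n K) :
    leftAct W (rightShift Z j η) = rightShift Z j (leftAct W η) := by
  funext k l s
  simp only [leftAct_apply, rightShift_apply, map_sum, map_smul, Finset.smul_sum]
  rw [Finset.sum_comm]

theorem rightAct_leftShift (Z : ∀ k, ncBall d (n k))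
    (W : ∀ k, Matrix (Fin (n k)) (Fin (n k)) (H →L[ℂ] K)) (j : Fin d) (η : BlockVec n K) :
    rightAct W (leftShift Z j η) = leftShift Z j (rightAct W η) := by
  funext k l s
  simp only [rightAct_apply, leftShift_apply, map_sum, map_smul, Finset.smul_sum]
  rw [Finset.sum_comm]

open scoped Classical in
theorem exists_multiplier_leftAct (Z : ∀ k, ncBall d (n k))
    (W : ∀ k, Matrix (Fin (n k)) (Fin (n k)) (H →L[ℂ] K))
    (h : ∀ η, ‖kerSum Z (leftAct W η)‖ ≤ ‖kerSum Z η‖) :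
    ∃ F : Fock d H →L[ℂ] Fock d K, (∀ u, ‖F u‖ ≤ ‖u‖) ∧
      (∀ g h b, F (lp.single 2 g h) (b * g) = F (lp.single 2 1 h) b) ∧
      (∀ g h a, (∀ b, a ≠ b * g) → F (lp.single 2 g h) a = 0) ∧
      ∀ η u, inner ℂ (kerSum Z η) (F u) = inner ℂ (kerSum Z (leftAct W η)) u := by
  -- the linear maps are made opaque, since unfolding them is expensive
  obtain ⟨R, hR⟩ : ∃ R : Fin d → BlockVec n K →ₗ[ℂ] BlockVec n K, R = rightShift Z := ⟨_, rfl⟩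
  obtain ⟨LK, hLK⟩ : ∃ L : BlockVec n K →ₗ[ℂ] Fock d K, L = kerSum Z := ⟨_, rfl⟩
  obtain ⟨LH, hLH⟩ : ∃ L : BlockVec n K →ₗ[ℂ] Fock d H, ∀ η, L η = kerSum Z (leftAct W η) :=
    ⟨kerSum Z ∘ₗ leftAct W, fun _ => rfl⟩
  obtain ⟨F, h1, h2, h3, h4⟩ := exists_lift R LK LH
    (fun j η a => by rw [hR, hLK, kerSum_rightShift])
    (fun j η a => by rw [hR, hLH, hLH, leftAct_rightShift, kerSum_rightShift])
    (fun η => by rw [hLH, hLK]; exact h η)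
  refine ⟨F, h1, h2, h3, fun η u => ?_⟩
  rw [← hLK, ← hLH, h4]

theorem exists_leftSchur (Z : ∀ k, ncBall d (n k))
    (W : ∀ k, Matrix (Fin (n k)) (Fin (n k)) (H →L[ℂ] K))
    (h : ∀ η, ‖kerSum Z (leftAct W η)‖ ≤ ‖kerSum Z η‖) :
    ∃ B ∈ leftSchur d H K, ∀ k, B (n k) (Z k) = W k := by
  classical
  obtain ⟨F, hF, h1, h2, hinner⟩ := exists_multiplier_leftAct Z W h
  refine ⟨symbol F, ⟨isFree_symbol F, fun f => ⟨F f, hF f, hardyFun_eq_leftProd F h1 h2 f⟩⟩,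
    fun k => ?_⟩
  ext i l x
  have hx : (fun k => Matrix.of fun i l => symbol F (n k) (Z k) i l x) =
      fun k => Matrix.of fun i l => W k i l x := by
    refine eq_of_sum_inner_eq fun η => ?_
    -- A constant `x` takes the value `I ⊗ x` at every point, so both products reduce to the entries
    -- of the symbol and of `W k` applied to `x`.
    have := hinner η (lp.single 2 1 x)
    rw [inner_kerSum_leftAct, inner_kerSum] at this
    simpa [symbol_apply, leftProd, hardyFun_single_one, apply_ite] using this
  exact congrFun (congrFun (congrFun hx k) i) l

open scoped Classical in
theorem exists_multiplier_rightAct (Z : ∀ k, ncBall d (n k))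
    (W : ∀ k, Matrix (Fin (n k)) (Fin (n k)) (H →L[ℂ] K))
    (h : ∀ η, ‖kerSum Z (rightAct W η)‖ ≤ ‖kerSum Z η‖) :
    ∃ F : Fock d H →L[ℂ] Fock d K, (∀ u, ‖F u‖ ≤ ‖u‖) ∧
      (∀ g h b, F (lp.single 2 g h) (g * b) = F (lp.single 2 1 h) b) ∧
      (∀ g h a, (∀ b, a ≠ g * b) → F (lp.single 2 g h) a = 0) ∧
      ∀ η u, inner ℂ (kerSum Z η) (F u) = inner ℂ (kerSum Z (rightAct W η)) u := by
  -- the linear maps are made opaque, since unfolding them is expensive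
  obtain ⟨R, hR⟩ : ∃ R : Fin d → BlockVec n K →ₗ[ℂ] BlockVec n K, R = leftShift Z := ⟨_, rfl⟩
  obtain ⟨LK, hLK⟩ : ∃ L : BlockVec n K →ₗ[ℂ] Fock d K, L = kerSum Z := ⟨_, rfl⟩
  obtain ⟨LH, hLH⟩ : ∃ L : BlockVec n K →ₗ[ℂ] Fock d H, ∀ η, L η = kerSum Z (rightAct W η) :=
    ⟨kerSum Z ∘ₗ rightAct W, fun _ => rfl⟩
  obtain ⟨F, h1, h2, h3, h4⟩ := exists_lift_reverse R LK LH
    (fun j η a => by rw [hR, hLK, kerSum_leftShift])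
    (fun j η a => by rw [hR, hLH, hLH, rightAct_leftShift, kerSum_leftShift])
    (fun η => by rw [hLH, hLK]; exact h η)
  refine ⟨F, h1, h2, h3, fun η u => ?_⟩
  rw [← hLK, ← hLH, h4]

theorem exists_rightSchur (Z : ∀ k, ncBall d (n k))
    (W : ∀ k, Matrix (Fin (n k)) (Fin (n k)) (H →L[ℂ] K))
    (h : ∀ η, ‖kerSum Z (rightAct W η)‖ ≤ ‖kerSum Z η‖) :
    ∃ B ∈ rightSchur d H K, ∀ k, B (n k) (Z k) = W k := by
  classical
  obtain ⟨F, hF, h1, h2, hinner⟩ := exists_multiplier_rightAct Z W h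
  refine ⟨symbol F, ⟨isFree_symbol F, fun f => ⟨F f, hF f, hardyFun_eq_rightProd F h1 h2 f⟩⟩,
    fun k => ?_⟩
  ext i l x
  have hx : (fun k => Matrix.of fun i l => symbol F (n k) (Z k) i l x) =
      fun k => Matrix.of fun i l => W k i l x := by
    refine eq_of_sum_inner_eq fun η => ?_
    have := hinner η (lp.single 2 1 x)
    rw [inner_kerSum_rightAct, inner_kerSum] at this
    simpa [symbol_apply, rightProd, hardyFun_single_one, apply_ite] using this
  exact congrFun (congrFun (congrFun hx k) i) l

end Interpolation

end FreePick

end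

theorem theorem6p1 {d N : ℕ} {H K : Type*}
    [NormedAddCommGroup H] [InnerProductSpace ℂ H] [CompleteSpace H]
    [NormedAddCommGroup K] [InnerProductSpace ℂ K] [CompleteSpace K]
    (n : Fin N → ℕ) (Z : ∀ k, FreePick.ncBall d (n k))
    (W : ∀ k, Matrix (Fin (n k)) (Fin (n k)) (H →L[ℂ] K)) :
    ((∃ B ∈ FreePick.leftSchur d H K, ∀ k, B (n k) (Z k) = W k) ↔
        FreePick.CompletelyPositive (FreePick.leftPick Z W)) ∧
      ((∃ B ∈ FreePick.rightSchur d H K, ∀ k, B (n k) (Z k) = W k) ↔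
        FreePick.CompletelyPositive (FreePick.rightPick Z W)) := by
  refine ⟨?_, ?_⟩
  · rw [FreePick.completelyPositive_leftPick_iff]
    exact ⟨fun ⟨B, hB, hW⟩ => FreePick.norm_kerSum_leftAct_le Z W B hB hW,
      FreePick.exists_leftSchur Z W⟩
  · rw [FreePick.completelyPositive_rightPick_iff]
    exact ⟨fun ⟨B, hB, hW⟩ => FreePick.norm_kerSum_rightAct_le Z W B hB hW,
      FreePick.exists_rightSchur Z W⟩
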